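/- Let $m$ be Lebesgue measure on $\mathbb C$, and let $\chi\colon\mathbb C\to[0,\infty)$ be a compactly supported smooth function with $\int\chi\,dm=1$ and $\chi(-z)=\chi(z)$ for all $z$. There exists a constant $C\ge 1$, depending only on $\chi$, with the following property. For an entire function $\psi\colon\mathbb C\to\mathbb C$ put $$\phi(z)=\tfrac12\log|\psi(z)|-\tfrac14|z|^2\in[-\infty,\infty),\qquad (|\phi|*\chi)(w)=\int_{\mathbb C}|\phi(z)|\,\chi(w-z)\,dm(z)\in[0,\infty],$$ $$R(z)=\sup_{w\in\mathbb C}\Bigl(\sqrt{C\,\bigl(1+(|\phi|*\chi)(w)\bigr)}-|w-z|\Bigr)\in[1,\infty].$$ If $R(0)<\infty$, then there exists a bijection between the lattice $\sqrt\pi\,\mathbb Z^2=\{\sqrt\pi(k+li):k,l\in\mathbb Z\}$ and the zeros of $\psi$, each zero being counted as many times as its multiplicity, such that every zero $z$ and the lattice point $p$ corresponding to it satisfy $$|z-p|\le R(p).$$ -/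

import Mathlib

open scoped ENNReal NNReal

noncomputable section

namespace PerturbedLattice

/-- The smoothing kernel: a smooth compactly supported function `χ : ℂ → [0, ∞)` of total
integral one with respect to Lebesgue measure, symmetric under `z ↦ -z`. -/
structure IsKernel (χ : ℂ → ℝ) : Prop where
  smooth : ContDiff ℝ ((⊤ : ℕ∞) : WithTop ℕ∞) χ
  compactSupport : HasCompactSupport χ
  nonneg : ∀ z, 0 ≤ χ z
  integral_eq_one : ∫ z, χ z = 1
  even : ∀ z, χ (-z) = χ z

/-- The potential `φ(z) = (1/2) log |ψ(z)| - (1/4) |z|²`, with values in `[-∞, ∞)`;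
it is `-∞` exactly at the zeros of `ψ`. -/
def potential (ψ : ℂ → ℂ) (z : ℂ) : EReal :=
  ((1 / 2 : ℝ) : EReal) * ENNReal.log ‖ψ z‖ₑ - ((‖z‖ ^ 2 / 4 : ℝ) : EReal)

/-- The convolution `(|φ| * χ)(w) = ∫ |φ(z)| χ(w - z) dm(z)`, with values in `[0, ∞]`. -/
def absPotentialConv (χ : ℂ → ℝ) (ψ : ℂ → ℂ) (w : ℂ) : ℝ≥0∞ :=
  ∫⁻ z, (potential ψ z).abs * ENNReal.ofReal (χ (w - z))

/-- The function `R(z) = max_w (√(C (1 + (|φ| * χ)(w))) - |w - z|)`, with values in `[0, ∞]`.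
The subtraction is truncated at zero, which does not affect the supremum, because the term
`w = z` is nonnegative. -/
def radius (C : ℝ≥0) (χ : ℂ → ℝ) (ψ : ℂ → ℂ) (z : ℂ) : ℝ≥0∞ :=
  ⨆ w : ℂ, ((C : ℝ≥0∞) * (1 + absPotentialConv χ ψ w)) ^ (1 / 2 : ℝ) - ‖w - z‖ₑ

/-- The lattice `√π ℤ² = {√π (k + l i) : k, l ∈ ℤ}`. -/
def lattice : Set ℂ :=
  {p | ∃ k l : ℤ, p = (Real.sqrt Real.pi : ℂ) * ((k : ℂ) + (l : ℂ) * Complex.I)}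

/-- The zeros of `ψ` counted with multiplicity: a zero `z` of multiplicity `n` gives the
`n` elements `(z, 0), …, (z, n - 1)`. -/
def zerosWithMultiplicity (ψ : ℂ → ℂ) : Set (ℂ × ℕ) :=
  {q | ψ q.1 = 0 ∧ (q.2 : ℕ∞) < analyticOrderAt ψ q.1}

end PerturbedLattice

end

namespace PerturbedLattice

open MeasureTheory Set Filter Topology Laplacian InnerProductSpace

/-! Since `log |z - a|` has distributional Laplacian `2πδ_a` and `|z|²/4` has Laplacian `1`, the
potential satisfies `Δφ = π Σ δ_a - 1`, summed over zeros with multiplicity. Testing against a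
compactly supported C² function `h` gives `π Σ h(a) = ∫ h + ∫ φ Δh`
(`integrable_realPotential_mul_laplacian_and_eq`). Lattice cells have area `π`, so counting zeros
against lattice points amounts to controlling `∫ φ Δh` for smoothed indicators `h`.

The radius `R` is 1-Lipschitz, so it serves as a local length scale. A bump at scale `s` comparable
to `R` has Laplacian `O(s⁻²)`, while `C(1 + |φ| * χ) ≤ R²` makes the integral of `|φ|` over its box
`O(s⁴/C)`. For `C` large the error `∫ |φ Δ(bump)|` is therefore at most the mass of the bump
(`exists_constant`). Cubic B-splines satisfy a refinement equation with nonnegative coefficients, so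
a coarse uniform partition of unity can be subdivided until every piece has scale comparable to `R`
(`exists_adaptedFamily_partition`).

Let `J` be a set of pieces, `N` the pieces meeting `J`, and `h` the sum over `J` or over `N`.
Because the whole partition sums to one, `Δh` is, up to sign, either zero or the Laplacian of the
sum over `N \ J`. Hence the error for `h` is at most `mass N - mass J`
(`IsPartition.abs_integral_le`). So `N` carries at least `mass J / π` zeros, and `J` carries at most
`mass N / π`. Taking for `J` the pieces meeting given lattice cells, or containing given zeros,
yields Hall's condition in both directions. The two resulting injections combine into a bijection by
a Schröder–Bernstein theorem that preserves the distance relation. -/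

/-! ### Green's second identity against compactly supported test functions -/

/-- Second derivatives computed through `iteratedFDeriv` and through iterated directional
derivatives agree. -/
lemma iteratedFDeriv_two_eq_fderiv_fderiv {f : ℂ → ℝ} {z : ℂ} (hf : ContDiffAt ℝ 2 f z) (v : ℂ) :
    iteratedFDeriv ℝ 2 f z ![v, v] = fderiv ℝ (fun w => fderiv ℝ f w v) z v := by
  have h1 : DifferentiableAt ℝ (fderiv ℝ f) z :=
    (hf.fderiv_right (m := 1) (by norm_num)).differentiableAt (by norm_num)
  rw [iteratedFDeriv_two_apply]
  have := (h1.hasFDerivAt.clm_apply (hasFDerivAt_const v z)).fderiv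
  rw [this]
  simp

lemma laplacian_eq_fderiv_fderiv {f : ℂ → ℝ} {z : ℂ} (hf : ContDiffAt ℝ 2 f z) :
    Δ f z = fderiv ℝ (fun w => fderiv ℝ f w 1) z 1
      + fderiv ℝ (fun w => fderiv ℝ f w Complex.I) z Complex.I := by
  rw [laplacian_eq_iteratedFDeriv_complexPlane]
  simp only [iteratedFDeriv_two_eq_fderiv_fderiv hf]

lemma laplacian_eq_of_hasFDerivAt {f A B : ℂ → ℝ} {A' B' : ℂ →L[ℝ] ℝ} {z : ℂ}
    (hf : ContDiffAt ℝ 2 f z)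
    (h : ∀ w, HasFDerivAt f (A w • Complex.reCLM + B w • Complex.imCLM) w)
    (hA : HasFDerivAt A A' z) (hB : HasFDerivAt B B' z) :
    Δ f z = A' 1 + B' Complex.I := by
  have h1 : (fun w => fderiv ℝ f w 1) = A := by
    ext w; rw [(h w).fderiv]; simp
  have h2 : (fun w => fderiv ℝ f w Complex.I) = B := by
    ext w; rw [(h w).fderiv]; simp
  rw [laplacian_eq_fderiv_fderiv hf, h1, h2, hA.fderiv, hB.fderiv]

lemma continuous_mul_of_tsupport {f k : ℂ → ℝ} (hk : Continuous k)
    (hf : ∀ z ∈ tsupport k, ContinuousAt f z) : Continuous fun z => f z * k z := by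
  rw [continuous_iff_continuousAt]
  intro z
  by_cases hz : z ∈ tsupport k
  · exact (hf z hz).mul hk.continuousAt
  · have : (fun z => f z * k z) =ᶠ[𝓝 z] fun _ => 0 := by
      filter_upwards [notMem_tsupport_iff_eventuallyEq.1 hz] with w hw
      simp [hw]
    exact continuousAt_const.congr this.symm

lemma integrable_mul_of_tsupport {f k : ℂ → ℝ} (hk : Continuous k) (hc : HasCompactSupport k)
    (hf : ∀ z ∈ tsupport k, ContinuousAt f z) : Integrable fun z => f z * k z :=
  (continuous_mul_of_tsupport hk hf).integrable_of_hasCompactSupport hc.mul_left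

lemma contDiff_fderiv_apply {h : ℂ → ℝ} {m n : WithTop ℕ∞} (hh : ContDiff ℝ n h) (hmn : m + 1 ≤ n)
    (v : ℂ) : ContDiff ℝ m (fun w => fderiv ℝ h w v) :=
  (hh.fderiv_right hmn).clm_apply contDiff_const

lemma tsupport_fderiv_apply_le (h : ℂ → ℝ) (v : ℂ) :
    tsupport (fun w => fderiv ℝ h w v) ⊆ tsupport h :=
  closure_minimal (fun z hz => support_fderiv_subset ℝ (f := h) (by
    intro h0; apply hz; simp [h0])) (isClosed_tsupport h)

/-- Two integrations by parts. Regularity of `f` is asked only on the support of `h`, because `f`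
will be `log |g|` with `g` possibly vanishing elsewhere. -/
lemma integral_mul_fderiv_fderiv {f h : ℂ → ℝ} (hh : ContDiff ℝ 2 h) (hc : HasCompactSupport h)
    (hf : ∀ z ∈ tsupport h, ContDiffAt ℝ 2 f z) (v : ℂ) :
    ∫ z, f z * fderiv ℝ (fun w => fderiv ℝ h w v) z v
      = ∫ z, fderiv ℝ (fun w => fderiv ℝ f w v) z v * h z := by
  have k1 : ContDiff ℝ 1 (fun w => fderiv ℝ h w v) := contDiff_fderiv_apply hh (by norm_num) v
  have k2 : Continuous (fun z => fderiv ℝ (fun w => fderiv ℝ h w v) z v) :=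
    (contDiff_fderiv_apply (m := 0) k1 (by norm_num) v).continuous
  have s1 := tsupport_fderiv_apply_le h v
  have s2 := (tsupport_fderiv_apply_le (fun w => fderiv ℝ h w v) v).trans s1
  have c1 : HasCompactSupport (fun w => fderiv ℝ h w v) := hc.of_isClosed_subset
    (isClosed_tsupport _) s1
  have c2 : HasCompactSupport (fun z => fderiv ℝ (fun w => fderiv ℝ h w v) z v) :=
    hc.of_isClosed_subset (isClosed_tsupport _) s2
  have f1 : ∀ z ∈ tsupport h, ContDiffAt ℝ 1 (fun w => fderiv ℝ f w v) z := fun z hz =>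
    ((hf z hz).fderiv_right (m := 1) (by norm_num)).clm_apply contDiffAt_const
  have f2 : ∀ z ∈ tsupport h, ContDiffAt ℝ 0 (fun z => fderiv ℝ (fun w => fderiv ℝ f w v) z v) z :=
    fun z hz => ((f1 z hz).fderiv_right (m := 0) (by norm_num)).clm_apply contDiffAt_const
  rw [integral_mul_fderiv_eq_neg_fderiv_mul_of_integrable,
    integral_mul_fderiv_eq_neg_fderiv_mul_of_integrable, neg_neg]
  · exact integrable_mul_of_tsupport hh.continuous hc fun z hz => (f2 z hz).continuousAt
  · exact integrable_mul_of_tsupport k1.continuous c1 fun z hz => (f1 z (s1 hz)).continuousAt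
  · exact integrable_mul_of_tsupport hh.continuous hc fun z hz => (f1 z hz).continuousAt
  · exact fun z hz => (f1 z hz).differentiableAt (by norm_num)
  · exact fun z _ => hh.differentiable (by norm_num) z
  · exact integrable_mul_of_tsupport k1.continuous c1 fun z hz => (f1 z (s1 hz)).continuousAt
  · exact integrable_mul_of_tsupport k2 c2 fun z hz => (hf z (s2 hz)).continuousAt
  · exact integrable_mul_of_tsupport k1.continuous c1 fun z hz => (hf z (s1 hz)).continuousAt
  · exact fun z hz => (hf z (s1 hz)).differentiableAt (by norm_num)
  · exact fun z _ => k1.differentiable (by norm_num) z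

lemma continuous_laplacian {h : ℂ → ℝ} (hh : ContDiff ℝ 2 h) : Continuous (Δ h) := by
  have : Δ h = fun z => fderiv ℝ (fun w => fderiv ℝ h w 1) z 1
      + fderiv ℝ (fun w => fderiv ℝ h w Complex.I) z Complex.I := by
    ext z; exact laplacian_eq_fderiv_fderiv hh.contDiffAt
  rw [this]
  exact (contDiff_fderiv_apply (m := 0)
      (contDiff_fderiv_apply (m := 1) hh (by norm_num) 1) (by norm_num) 1).continuous.add
    (contDiff_fderiv_apply (m := 0) (contDiff_fderiv_apply (m := 1) hh (by norm_num) _)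
      (by norm_num) _).continuous

lemma tsupport_laplacian_subset (h : ℂ → ℝ) : tsupport (Δ h) ⊆ tsupport h := by
  refine closure_minimal (fun z hz => ?_) (isClosed_tsupport h)
  by_contra hz'
  have h0 := (laplacian_congr_nhds (notMem_tsupport_iff_eventuallyEq.1 hz')).eq_of_nhds
  have : Δ (fun _ : ℂ => (0 : ℝ)) z = 0 := by rw [laplacian_const]; rfl
  exact hz (h0.trans this)

lemma hasCompactSupport_laplacian {h : ℂ → ℝ} (hc : HasCompactSupport h) :
    HasCompactSupport (Δ h) :=
  hc.of_isClosed_subset (isClosed_tsupport _) (tsupport_laplacian_subset h)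

/-- Green's second identity for a compactly supported test function. -/
lemma integral_mul_laplacian {f h : ℂ → ℝ} (hh : ContDiff ℝ 2 h) (hc : HasCompactSupport h)
    (hf : ∀ z ∈ tsupport h, ContDiffAt ℝ 2 f z) :
    ∫ z, f z * Δ h z = ∫ z, Δ f z * h z := by
  have s : ∀ v : ℂ, tsupport (fun z => fderiv ℝ (fun w => fderiv ℝ h w v) z v) ⊆ tsupport h :=
    fun v => (tsupport_fderiv_apply_le (fun w => fderiv ℝ h w v) v).trans
      (tsupport_fderiv_apply_le h v)
  have i1 : ∀ v : ℂ, Integrable fun z => f z * fderiv ℝ (fun w => fderiv ℝ h w v) z v := fun v =>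
    integrable_mul_of_tsupport (contDiff_fderiv_apply (m := 0)
      (contDiff_fderiv_apply (m := 1) hh (by norm_num) v) (by norm_num) v).continuous
      (hc.of_isClosed_subset (isClosed_tsupport _) (s v))
      fun z hz => (hf z (s v hz)).continuousAt
  have i2 : ∀ v : ℂ, Integrable fun z => fderiv ℝ (fun w => fderiv ℝ f w v) z v * h z := fun v =>
    integrable_mul_of_tsupport hh.continuous hc fun z hz =>
      ((((hf z hz).fderiv_right (m := 1) (by norm_num)).clm_apply
        contDiffAt_const).fderiv_right (m := 0) (by norm_num)
        |>.clm_apply contDiffAt_const).continuousAt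
  calc ∫ z, f z * Δ h z
      = ∫ z, (f z * fderiv ℝ (fun w => fderiv ℝ h w 1) z 1
        + f z * fderiv ℝ (fun w => fderiv ℝ h w Complex.I) z Complex.I) := by
        congr 1; ext z; rw [laplacian_eq_fderiv_fderiv hh.contDiffAt]; ring
    _ = ∫ z, (fderiv ℝ (fun w => fderiv ℝ f w 1) z 1 * h z
        + fderiv ℝ (fun w => fderiv ℝ f w Complex.I) z Complex.I * h z) := by
        rw [integral_add (i1 _) (i1 _), integral_add (i2 _) (i2 _),
          integral_mul_fderiv_fderiv hh hc hf, integral_mul_fderiv_fderiv hh hc hf]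
    _ = ∫ z, Δ f z * h z := by
        congr 1; ext z
        by_cases hz : z ∈ tsupport h
        · rw [laplacian_eq_fderiv_fderiv (hf z hz)]; ring
        · simp [image_eq_zero_of_notMem_tsupport hz]

/-! ### The logarithm as fundamental solution of the Laplacian -/

/-- In polar coordinates the integrand becomes `r log r`, which is continuous up to `r = 0`. -/
lemma locallyIntegrable_log_norm : LocallyIntegrable fun z : ℂ => Real.log ‖z‖ := by
  rw [locallyIntegrable_iff]
  intro K hK
  obtain ⟨r, hr⟩ := hK.isBounded.subset_ball (0 : ℂ)
  refine IntegrableOn.mono_set ?_ hr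
  rw [integrableOn_fun_norm_addHaar (μ := volume) (E := ℂ) (f := Real.log)]
  simp only [Complex.finrank_real_complex, Nat.add_one_sub_one, pow_one, smul_eq_mul]
  exact (Real.continuous_mul_log.integrableOn_Icc (a := 0) (b := r)).mono_set Ioo_subset_Icc_self

lemma integrable_log_norm_sub_mul {k : ℂ → ℝ} (hk : Continuous k) (hc : HasCompactSupport k)
    (a : ℂ) : Integrable fun z => Real.log ‖z - a‖ * k z := by
  have h1 : Integrable fun z : ℂ => Real.log ‖z‖ * k (z + a) := by
    have := locallyIntegrable_log_norm.integrable_smul_right_of_hasCompactSupport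
      (g := fun z => k (z + a)) (hk.comp (continuous_id.add continuous_const))
      (hc.comp_homeomorph (Homeomorph.addRight a))
    simpa [mul_comm] using this
  simpa using h1.comp_sub_right a

/-- A smooth approximation of `z ↦ log ‖z - a‖`. -/
noncomputable def regLog (a : ℂ) (ε : ℝ) (z : ℂ) : ℝ :=
  1 / 2 * Real.log ((z.re - a.re) ^ 2 + (z.im - a.im) ^ 2 + ε)

lemma norm_sub_sq (z a : ℂ) : ‖z - a‖ ^ 2 = (z.re - a.re) ^ 2 + (z.im - a.im) ^ 2 := by
  rw [← Complex.normSq_eq_norm_sq, Complex.normSq_apply]; simp; ring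

lemma contDiff_re : ContDiff ℝ 2 Complex.re := Complex.reCLM.contDiff
lemma contDiff_im : ContDiff ℝ 2 Complex.im := Complex.imCLM.contDiff

lemma contDiff_regLog (a : ℂ) {ε : ℝ} (hε : 0 < ε) : ContDiff ℝ 2 (regLog a ε) := by
  unfold regLog
  refine contDiff_const.mul (ContDiff.log ?_ fun z => by positivity)
  exact (((contDiff_re.sub contDiff_const).pow 2).add
    ((contDiff_im.sub contDiff_const).pow 2)).add contDiff_const

lemma laplacian_regLog (a : ℂ) {ε : ℝ} (hε : 0 < ε) (z : ℂ) :
    Δ (regLog a ε) z = 2 * ε / (‖z - a‖ ^ 2 + ε) ^ 2 := by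
  have hre : ∀ w, HasFDerivAt (fun w : ℂ => w.re - a.re) Complex.reCLM w := fun w =>
    Complex.reCLM.hasFDerivAt.sub_const _
  have him : ∀ w, HasFDerivAt (fun w : ℂ => w.im - a.im) Complex.imCLM w := fun w =>
    Complex.imCLM.hasFDerivAt.sub_const _
  have hq0 : ∀ w : ℂ, (w.re - a.re) ^ 2 + (w.im - a.im) ^ 2 + ε ≠ 0 := fun w => by positivity
  have hq : ∀ w, HasFDerivAt (fun w : ℂ => (w.re - a.re) ^ 2 + (w.im - a.im) ^ 2 + ε)
      ((2 * (w.re - a.re)) • Complex.reCLM + (2 * (w.im - a.im)) • Complex.imCLM) w := fun w => by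
    convert! (((hre w).pow 2).add ((him w).pow 2)).add_const ε using 1
    simp
  have hA : ∀ w, HasFDerivAt (regLog a ε)
      (((w.re - a.re) * ((w.re - a.re) ^ 2 + (w.im - a.im) ^ 2 + ε)⁻¹) • Complex.reCLM
        + ((w.im - a.im) * ((w.re - a.re) ^ 2 + (w.im - a.im) ^ 2 + ε)⁻¹) • Complex.imCLM) w := by
    intro w
    convert! ((hq w).log (hq0 w)).const_mul (1 / 2 : ℝ) using 1
    ext <;> (simp; ring)
  have hinv := (hasDerivAt_inv (hq0 z)).comp_hasFDerivAt z (hq z)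
  rw [laplacian_eq_of_hasFDerivAt (contDiff_regLog a hε).contDiffAt hA
    ((hre z).mul hinv) ((him z).mul hinv), norm_sub_sq]
  have := hq0 z
  simp
  field_simp
  ring

/-- Moving the Laplacian onto `regLog` and substituting `z = a + δw` turns it into a fixed kernel in
`w`, so `δ` survives only in the argument of `h`. -/
lemma integral_regLog_mul_laplacian {h : ℂ → ℝ} (hh : ContDiff ℝ 2 h) (hc : HasCompactSupport h)
    (a : ℂ) {δ : ℝ} (hδ : 0 < δ) :
    ∫ z, regLog a (δ ^ 2) z * Δ h z = ∫ w : ℂ, 2 / (‖w‖ ^ 2 + 1) ^ 2 * h (a + δ • w) := by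
  rw [integral_mul_laplacian hh hc fun z _ => (contDiff_regLog a (by positivity)).contDiffAt]
  have h1 : ∫ z, Δ (regLog a (δ ^ 2)) z * h z
      = ∫ z : ℂ, 2 * δ ^ 2 / (‖z‖ ^ 2 + δ ^ 2) ^ 2 * h (a + z) := by
    rw [← integral_add_left_eq_self _ a]
    congr 1; ext z
    rw [laplacian_regLog a (by positivity)]; simp
  have h2 := Measure.integral_comp_smul (volume : Measure ℂ)
    (fun z : ℂ => 2 * δ ^ 2 / (‖z‖ ^ 2 + δ ^ 2) ^ 2 * h (a + z)) δ
  rw [h1]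
  simp only [Complex.finrank_real_complex, smul_eq_mul] at h2
  have h3 : ∫ z : ℂ, 2 * δ ^ 2 / (‖z‖ ^ 2 + δ ^ 2) ^ 2 * h (a + z)
      = δ ^ 2 * ∫ x : ℂ, 2 * δ ^ 2 / (‖δ • x‖ ^ 2 + δ ^ 2) ^ 2 * h (a + δ • x) := by
    rw [h2, abs_of_pos (by positivity)]; field_simp
  rw [h3, ← integral_const_mul]
  congr 1; ext w
  rw [norm_smul, Real.norm_of_nonneg hδ.le]
  have : (0 : ℝ) < ‖w‖ ^ 2 + 1 := by positivity
  field_simp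

/-- The radial antiderivative behind the integrability and the total mass `2π` of the kernel `2 /
(‖w‖² + 1)²`. -/
lemma hasDerivAt_neg_inv_sq_add_one (r : ℝ) :
    HasDerivAt (fun r : ℝ => -(r ^ 2 + 1)⁻¹) (r * (2 / (r ^ 2 + 1) ^ 2)) r := by
  have h0 : r ^ 2 + 1 ≠ 0 := by positivity
  convert! (((hasDerivAt_pow 2 r).add_const (1 : ℝ)).inv h0).neg using 1
  simp; field_simp

lemma tendsto_neg_inv_sq_add_one : Tendsto (fun r : ℝ => -(r ^ 2 + 1)⁻¹) atTop (𝓝 0) := by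
  rw [← neg_zero]
  exact (tendsto_inv_atTop_zero.comp
    (tendsto_atTop_add_const_right _ 1 (tendsto_pow_atTop two_ne_zero))).neg

lemma integrable_two_div_sq : Integrable fun w : ℂ => 2 / (‖w‖ ^ 2 + 1) ^ 2 := by
  rw [integrable_fun_norm_addHaar (μ := volume) (E := ℂ) (f := fun r => 2 / (r ^ 2 + 1) ^ 2)]
  simp only [Complex.finrank_real_complex, Nat.add_one_sub_one, pow_one, smul_eq_mul]
  refine integrableOn_Ioi_deriv_of_nonneg' (fun r _ => hasDerivAt_neg_inv_sq_add_one r)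
    (fun r hr => ?_) tendsto_neg_inv_sq_add_one
  have : (0 : ℝ) < r := hr
  positivity

lemma integral_two_div_sq : ∫ w : ℂ, 2 / (‖w‖ ^ 2 + 1) ^ 2 = 2 * Real.pi := by
  rw [integral_fun_norm_addHaar (μ := volume) (E := ℂ) (f := fun r => 2 / (r ^ 2 + 1) ^ 2)]
  simp only [Complex.finrank_real_complex, Nat.add_one_sub_one, pow_one, smul_eq_mul]
  rw [integral_Ioi_of_hasDerivAt_of_nonneg' (fun r _ => hasDerivAt_neg_inv_sq_add_one r)
    (fun r hr => by have : (0 : ℝ) < r := hr; positivity) tendsto_neg_inv_sq_add_one]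
  simp [Measure.real, Complex.volume_ball]

/-- Monotonicity in `ε` squeezes `regLog a ε` between `log ‖z - a‖` and `regLog a 1`; this supplies
the dominating function for `ε → 0`. -/
lemma abs_regLog_le {a z : ℂ} (hz : z ≠ a) {ε : ℝ} (hε : 0 < ε) (hε1 : ε ≤ 1) :
    |regLog a ε z| ≤ |Real.log ‖z - a‖| + |regLog a 1 z| := by
  have h0 : 0 < ‖z - a‖ := norm_pos_iff.2 (sub_ne_zero.2 hz)
  have h1 : Real.log ‖z - a‖ = 1 / 2 * Real.log ((z.re - a.re) ^ 2 + (z.im - a.im) ^ 2) := by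
    rw [← norm_sub_sq, Real.log_pow]; push_cast; ring
  have hp : 0 < (z.re - a.re) ^ 2 + (z.im - a.im) ^ 2 := by rw [← norm_sub_sq]; positivity
  have l1 : Real.log ‖z - a‖ ≤ regLog a ε z := by
    rw [h1]; exact mul_le_mul_of_nonneg_left (Real.log_le_log hp (by linarith)) (by norm_num)
  have l2 : regLog a ε z ≤ regLog a 1 z := by unfold regLog; gcongr
  rw [abs_le]
  constructor
  · have := neg_abs_le (Real.log ‖z - a‖); have := abs_nonneg (regLog a 1 z); linarith
  · have := le_abs_self (regLog a 1 z); have := abs_nonneg (Real.log ‖z - a‖); linarith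

/-- The logarithm is `2π` times the fundamental solution of the Laplace equation. -/
lemma integral_log_norm_sub_mul_laplacian {h : ℂ → ℝ} (hh : ContDiff ℝ 2 h)
    (hc : HasCompactSupport h) (a : ℂ) :
    ∫ z, Real.log ‖z - a‖ * Δ h z = 2 * Real.pi * h a := by
  set δ : ℕ → ℝ := fun n => 1 / ((n : ℝ) + 1) with hδ
  have hδ0 : ∀ n, 0 < δ n := fun n => by positivity
  have hδ1 : ∀ n, δ n ^ 2 ≤ 1 := fun n => by
    refine pow_le_one₀ (hδ0 n).le ?_
    simp only [hδ]; rw [div_le_one (by positivity)]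
    have : (0 : ℝ) ≤ n := n.cast_nonneg
    linarith
  have hδt : Tendsto δ atTop (𝓝 0) := tendsto_one_div_add_atTop_nhds_zero_nat
  have cL := continuous_laplacian hh
  have sL := hasCompactSupport_laplacian hc
  -- The domination and the pointwise limit are only needed off the single point `a`.
  have hae : ∀ᵐ z : ℂ, z ≠ a := by simp [ae_iff]
  have t1 : Tendsto (fun n => ∫ z, regLog a (δ n ^ 2) z * Δ h z) atTop
      (𝓝 (∫ z, Real.log ‖z - a‖ * Δ h z)) := by
    refine tendsto_integral_of_dominated_convergence
      (fun z => |Real.log ‖z - a‖ * Δ h z| + |regLog a 1 z * Δ h z|) (fun n => ?_) ?_ ?_ ?_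
    · exact ((contDiff_regLog a (pow_pos (hδ0 n) 2)).continuous.mul cL).aestronglyMeasurable
    · exact (integrable_log_norm_sub_mul cL sL a).abs.add (integrable_mul_of_tsupport cL sL
        fun z _ => (contDiff_regLog a one_pos).continuous.continuousAt).abs
    · intro n
      filter_upwards [hae] with z hz
      rw [Real.norm_eq_abs, abs_mul, abs_mul, abs_mul, ← add_mul]
      exact mul_le_mul_of_nonneg_right (abs_regLog_le hz (pow_pos (hδ0 n) 2) (hδ1 n))
        (abs_nonneg _)
    · filter_upwards [hae] with z hz
      refine Tendsto.mul_const _ ?_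
      have h0 : 0 < ‖z - a‖ := norm_pos_iff.2 (sub_ne_zero.2 hz)
      have h1 : Real.log ‖z - a‖ = 1 / 2 * Real.log ((z.re - a.re) ^ 2 + (z.im - a.im) ^ 2 + 0 ^ 2)
          := by
        have : (0 : ℝ) ^ 2 = 0 := by norm_num
        rw [this, add_zero, ← norm_sub_sq, Real.log_pow]; push_cast; ring
      rw [h1]
      unfold regLog
      refine Tendsto.const_mul _ (Tendsto.log (Tendsto.add tendsto_const_nhds (hδt.pow 2)) ?_)
      have : (0 : ℝ) ^ 2 = 0 := by norm_num
      rw [this, add_zero, ← norm_sub_sq]; positivity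
  have t2 : Tendsto (fun n => ∫ w : ℂ, 2 / (‖w‖ ^ 2 + 1) ^ 2 * h (a + δ n • w)) atTop
      (𝓝 (∫ w : ℂ, 2 / (‖w‖ ^ 2 + 1) ^ 2 * h a)) := by
    obtain ⟨M, hM⟩ := hc.exists_bound_of_continuous hh.continuous
    have c0 : Continuous fun w : ℂ => 2 / (‖w‖ ^ 2 + 1) ^ 2 := by
      refine continuous_const.div (by fun_prop) fun w => by positivity
    refine tendsto_integral_of_dominated_convergence
      (fun w => 2 / (‖w‖ ^ 2 + 1) ^ 2 * M) (fun n => ?_) ?_ ?_ ?_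
    · exact (c0.mul (hh.continuous.comp (by fun_prop))).aestronglyMeasurable
    · exact integrable_two_div_sq.mul_const M
    · intro n
      filter_upwards with w
      rw [norm_mul, Real.norm_of_nonneg (by positivity)]
      exact mul_le_mul_of_nonneg_left (hM _) (by positivity)
    · filter_upwards with w
      refine Tendsto.const_mul _ ?_
      refine (hh.continuous.tendsto a).comp ?_
      have : Tendsto (fun n => a + δ n • w) atTop (𝓝 (a + (0 : ℝ) • w)) :=
        tendsto_const_nhds.add (hδt.smul_const w)
      simpa using this
  have e : (fun n => ∫ z, regLog a (δ n ^ 2) z * Δ h z)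
      = fun n => ∫ w : ℂ, 2 / (‖w‖ ^ 2 + 1) ^ 2 * h (a + δ n • w) :=
    funext fun n => integral_regLog_mul_laplacian hh hc a (hδ0 n)
  rw [e] at t1
  rw [tendsto_nhds_unique t1 t2, integral_mul_const, integral_two_div_sq]

/-! ### The distributional Laplacian of the potential -/

lemma laplacian_norm_sq_div_four (z : ℂ) : (Δ (fun z : ℂ => (‖z‖ ^ 2 / 4 : ℝ)) : ℂ → ℝ) z = 1 := by
  have e : (fun z : ℂ => (‖z‖ ^ 2 / 4 : ℝ)) = fun z : ℂ => z.re ^ 2 / 4 + z.im ^ 2 / 4 := by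
    ext z; have := norm_sub_sq z 0; simp at this; rw [this]; ring
  have hA : ∀ w, HasFDerivAt (fun z : ℂ => z.re ^ 2 / 4 + z.im ^ 2 / 4)
      ((w.re / 2) • Complex.reCLM + (w.im / 2) • Complex.imCLM) w := by
    intro w
    have h1 : HasFDerivAt (fun z : ℂ => z.re) Complex.reCLM w := Complex.reCLM.hasFDerivAt
    have h2 : HasFDerivAt (fun z : ℂ => z.im) Complex.imCLM w := Complex.imCLM.hasFDerivAt
    convert! ((h1.pow 2).mul_const (1 / 4 : ℝ)).add ((h2.pow 2).mul_const (1 / 4 : ℝ)) using 1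
    · ext z; simp; ring
    · ext <;> simp <;> ring
  have hc : ContDiff ℝ 2 fun z : ℂ => z.re ^ 2 / 4 + z.im ^ 2 / 4 :=
    ((contDiff_re.pow 2).div_const _).add ((contDiff_im.pow 2).div_const _)
  have h1 : HasFDerivAt (fun z : ℂ => z.re / 2) ((1 / 2 : ℝ) • Complex.reCLM) z := by
    convert! (Complex.reCLM.hasFDerivAt (x := z)).mul_const (1 / 2 : ℝ) using 1
    ext z; simp; ring
  have h2 : HasFDerivAt (fun z : ℂ => z.im / 2) ((1 / 2 : ℝ) • Complex.imCLM) z := by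
    convert! (Complex.imCLM.hasFDerivAt (x := z)).mul_const (1 / 2 : ℝ) using 1
    ext z; simp; ring
  rw [e, laplacian_eq_of_hasFDerivAt hc.contDiffAt hA h1 h2]
  simp; norm_num

lemma contDiff_norm_sq_div_four : ContDiff ℝ 2 fun z : ℂ => (‖z‖ ^ 2 / 4 : ℝ) :=
  (contDiff_norm_sq ℝ).div_const _

lemma exists_eq_pow_mul_of_entire (a : ℂ) (n : ℕ) : ∀ ψ : ℂ → ℂ, Differentiable ℂ ψ →
    analyticOrderAt ψ a = n →
    ∃ g : ℂ → ℂ, Differentiable ℂ g ∧ (∀ z, ψ z = (z - a) ^ n * g z) ∧ g a ≠ 0 := by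
  induction n with
  | zero =>
    intro ψ hψ hn
    refine ⟨ψ, hψ, by simp, ?_⟩
    exact (hψ.analyticAt a).analyticOrderAt_eq_zero.1 (by simpa using hn)
  | succ n ih =>
    intro ψ hψ hn
    have h0 : ψ a = 0 := apply_eq_zero_of_analyticOrderAt_ne_zero (by rw [hn]; simp)
    have hd : Differentiable ℂ (dslope ψ a) := by
      have := (Complex.differentiableOn_dslope (s := univ) (c := a) (f := ψ) univ_mem).2
        hψ.differentiableOn
      exact differentiableOn_univ.1 this
    have he : ∀ z, ψ z = (z - a) * dslope ψ a z := fun z => by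
      have := sub_smul_dslope ψ a z
      rw [smul_eq_mul, h0, sub_zero] at this
      exact this.symm
    have ho : analyticOrderAt (dslope ψ a) a = n := by
      have e : ψ = (fun z => z - a) * dslope ψ a := funext he
      have h1 := analyticOrderAt_mul (f := fun z => z - a) (g := dslope ψ a) (z₀ := a)
        (by fun_prop) (hd.analyticAt a)
      rw [← e, hn, analyticOrderAt_id_sub_const_self] at h1
      push_cast at h1
      generalize analyticOrderAt (dslope ψ a) a = x at h1
      cases x using ENat.recTopCoe with
      | top => simp at h1
      | coe x => norm_cast at h1 ⊢; omega
    obtain ⟨g, hg, hg1, hg2⟩ := ih _ hd ho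
    exact ⟨g, hg, fun z => by rw [he, hg1]; ring, hg2⟩

/-- The multiplicity of a zero. -/
noncomputable abbrev mult (ψ : ℂ → ℂ) (a : ℂ) : ℕ := analyticOrderNatAt ψ a

lemma analyticOrderAt_ne_top_of_entire {ψ : ℂ → ℂ} (hψ : Differentiable ℂ ψ) (h0 : ψ ≠ 0) (a : ℂ) :
    analyticOrderAt ψ a ≠ ⊤ := by
  intro h
  apply h0
  exact AnalyticOnNhd.eq_of_eventuallyEq (fun z _ => hψ.analyticAt z)
    (fun z _ => analyticAt_const) (analyticOrderAt_eq_top.1 h)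

/-- Zeros are divided out one at a time. The factor already removed does not vanish at the next
point `b`, so the remaining factor still has order `mult ψ b` there. -/
lemma exists_factorization {ψ : ℂ → ℂ} (hψ : Differentiable ℂ ψ) (h0 : ψ ≠ 0) (Z : Finset ℂ) :
    ∃ g : ℂ → ℂ, Differentiable ℂ g ∧ (∀ z, ψ z = (∏ a ∈ Z, (z - a) ^ mult ψ a) * g z) ∧
      ∀ a ∈ Z, g a ≠ 0 := by
  classical
  induction Z using Finset.induction_on with
  | empty => exact ⟨ψ, hψ, by simp, by simp⟩
  | insert b Z hb ih =>
    obtain ⟨g, hg, hg1, hg2⟩ := ih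
    have hP : AnalyticAt ℂ (fun z => ∏ a ∈ Z, (z - a) ^ mult ψ a) b := by fun_prop
    have hPb : (fun z => ∏ a ∈ Z, (z - a) ^ mult ψ a) b ≠ 0 := by
      refine Finset.prod_ne_zero_iff.2 fun a ha => pow_ne_zero _ (sub_ne_zero.2 ?_)
      rintro rfl; exact hb ha
    have ho : analyticOrderAt g b = mult ψ b := by
      have e : ψ = (fun z => ∏ a ∈ Z, (z - a) ^ mult ψ a) * g := funext hg1
      have h1 := analyticOrderAt_mul hP (hg.analyticAt b)
      rw [← e, hP.analyticOrderAt_eq_zero.2 hPb, zero_add] at h1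
      rw [← h1, Nat.cast_analyticOrderNatAt (analyticOrderAt_ne_top_of_entire hψ h0 b)]
    obtain ⟨k, hk, hk1, hk2⟩ := exists_eq_pow_mul_of_entire b _ g hg ho
    refine ⟨k, hk, fun z => ?_, fun a ha => ?_⟩
    · rw [Finset.prod_insert hb, hg1, hk1]; ring
    · rcases Finset.mem_insert.1 ha with rfl | ha
      · exact hk2
      · have := hg2 a ha
        rw [hk1] at this
        exact right_ne_zero_of_mul this

/-- The potential as a real function, with a junk value at the zeros. -/
noncomputable def realPotential (ψ : ℂ → ℂ) (z : ℂ) : ℝ :=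
  1 / 2 * Real.log ‖ψ z‖ - ‖z‖ ^ 2 / 4

lemma log_norm_mul_laplacian_ae_eq {ψ g : ℂ → ℂ} {h : ℂ → ℝ} {Z : Finset ℂ}
    (hg : ∀ z, ψ z = (∏ a ∈ Z, (z - a) ^ mult ψ a) * g z) (hg0 : ∀ z ∈ tsupport h, g z ≠ 0) :
    (fun z => Real.log ‖ψ z‖ * Δ h z) =ᵐ[volume] fun z =>
      (∑ a ∈ Z, (mult ψ a : ℝ) * (Real.log ‖z - a‖ * Δ h z)) + Real.log ‖g z‖ * Δ h z := by
  have hae : ∀ᵐ z : ℂ, z ∉ (Z : Set ℂ) := by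
    rw [ae_iff]; simpa using Z.finite_toSet.measure_zero volume
  filter_upwards [hae] with z hz
  by_cases hz' : z ∈ tsupport h
  · have hne : ∀ a ∈ Z, ‖z - a‖ ^ mult ψ a ≠ 0 := fun a ha => pow_ne_zero _
      (norm_ne_zero_iff.2 (sub_ne_zero.2 (by rintro rfl; exact hz ha)))
    rw [hg z, norm_mul, norm_prod]
    simp only [norm_pow]
    rw [Real.log_mul (Finset.prod_ne_zero_iff.2 hne) (norm_ne_zero_iff.2 (hg0 z hz')),
      Real.log_prod hne, add_mul, Finset.sum_mul]
    simp only [Real.log_pow, mul_assoc]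
  · have : Δ h z = 0 := image_eq_zero_of_notMem_tsupport
      fun h' => hz' (tsupport_laplacian_subset h h')
    simp [this]

/-- This is `Δφ = π Σ δ_a - 1` in weak form. Dividing out the zeros in `Z` leaves a factor `g`
without zeros on the support of `h`; there `log |g|` is harmonic and contributes nothing, while each
`log |z - a|` contributes `2π h(a)`. -/
lemma integrable_realPotential_mul_laplacian_and_eq {ψ : ℂ → ℂ} (hψ : Differentiable ℂ ψ)
    (h0 : ψ ≠ 0) {h : ℂ → ℝ} (hh : ContDiff ℝ 2 h) (hc : HasCompactSupport h) {Z : Finset ℂ}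
    (hZ : ∀ z ∈ tsupport h, ψ z = 0 → z ∈ Z) :
    Integrable (fun z => realPotential ψ z * Δ h z) ∧
    Real.pi * ∑ a ∈ Z, (mult ψ a : ℝ) * h a = (∫ z, h z) + ∫ z, realPotential ψ z * Δ h z := by
  obtain ⟨g, hg, hg1, hg2⟩ := exists_factorization hψ h0 Z
  have hg0 : ∀ z ∈ tsupport h, g z ≠ 0 := by
    intro z hz hgz
    have : ψ z = 0 := by rw [hg1, hgz, mul_zero]
    exact hg2 z (hZ z hz this) hgz
  have cL := continuous_laplacian hh
  have sL := hasCompactSupport_laplacian hc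
  have harm : ∀ z ∈ tsupport h, HarmonicAt (fun z => Real.log ‖g z‖) z := fun z hz =>
    (hg.analyticAt z).harmonicAt_log_norm (hg0 z hz)
  have i1 : Integrable fun z => Real.log ‖g z‖ * Δ h z := integrable_mul_of_tsupport cL sL
    fun z hz => (harm z (tsupport_laplacian_subset h hz)).1.continuousAt
  have e1 : ∫ z, Real.log ‖g z‖ * Δ h z = 0 := by
    rw [integral_mul_laplacian hh hc fun z hz => (harm z hz).1]
    refine integral_eq_zero_of_ae (Eventually.of_forall fun z => ?_)
    by_cases hz : z ∈ tsupport h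
    · simp [(harm z hz).2.eq_of_nhds]
    · simp [image_eq_zero_of_notMem_tsupport hz]
  have i2 : ∀ a ∈ Z, Integrable fun z => (mult ψ a : ℝ) * (Real.log ‖z - a‖ * Δ h z) :=
    fun a _ => (integrable_log_norm_sub_mul cL sL a).const_mul _
  have i2' := integrable_finsetSum Z i2
  have ae := log_norm_mul_laplacian_ae_eq (h := h) hg1 hg0
  have i3 : Integrable fun z => Real.log ‖ψ z‖ * Δ h z := (i2'.add i1).congr ae.symm
  have e3 : ∫ z, Real.log ‖ψ z‖ * Δ h z = 2 * Real.pi * ∑ a ∈ Z, (mult ψ a : ℝ) * h a := by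
    rw [integral_congr_ae ae, integral_add i2' i1, e1, add_zero, integral_finsetSum Z i2,
      Finset.mul_sum]
    refine Finset.sum_congr rfl fun a _ => ?_
    rw [integral_const_mul, integral_log_norm_sub_mul_laplacian hh hc]; ring
  have i4 : Integrable fun z => (‖z‖ ^ 2 / 4) * Δ h z := integrable_mul_of_tsupport cL sL
    fun z _ => contDiff_norm_sq_div_four.continuous.continuousAt
  have e4 : ∫ z, (‖z‖ ^ 2 / 4) * Δ h z = ∫ z, h z := by
    rw [integral_mul_laplacian hh hc fun z _ => contDiff_norm_sq_div_four.contDiffAt]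
    simp [laplacian_norm_sq_div_four]
  have e5 : (fun z => realPotential ψ z * Δ h z) = fun z =>
      1 / 2 * (Real.log ‖ψ z‖ * Δ h z) - ‖z‖ ^ 2 / 4 * Δ h z := by
    ext z; unfold realPotential; ring
  rw [e5]
  refine ⟨(i3.const_mul _).sub i4, ?_⟩
  rw [integral_sub (i3.const_mul _) i4, integral_const_mul, e3, e4]; ring

/-! ### Cubic B-splines on the line -/

/-- The truncated power `x ↦ max x 0 ^ k`. -/
noncomputable def truncPow (k : ℕ) (x : ℝ) : ℝ := max x 0 ^ k

lemma truncPow_of_nonneg {k : ℕ} {x : ℝ} (hx : 0 ≤ x) : truncPow k x = x ^ k := by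
  simp [truncPow, hx]

lemma truncPow_of_nonpos {k : ℕ} (hk : k ≠ 0) {x : ℝ} (hx : x ≤ 0) : truncPow k x = 0 := by
  simp [truncPow, hx, hk]

lemma hasDerivAt_truncPow {k : ℕ} (hk : 1 ≤ k) (x : ℝ) :
    HasDerivAt (truncPow (k + 1)) ((k + 1) * truncPow k x) x := by
  rcases lt_trichotomy x 0 with hx | rfl | hx
  · rw [truncPow_of_nonpos (by omega) hx.le, mul_zero]
    refine (hasDerivAt_const x (0 : ℝ)).congr_of_eventuallyEq ?_
    filter_upwards [Iio_mem_nhds hx] with y hy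
    exact truncPow_of_nonpos (by omega) (le_of_lt hy)
  · rw [truncPow_of_nonpos (by omega) le_rfl, mul_zero, hasDerivAt_iff_hasFDerivAt]
    have : (ContinuousLinearMap.toSpanSingleton ℝ (0 : ℝ)) = 0 := by ext; simp
    rw [this]
    -- At the knot the function is `O(|y|^(k+1))` with `k + 1 ≥ 2`, so its derivative is zero.
    refine Asymptotics.IsBigO.hasFDerivAt (n := k + 1) ?_ (by omega)
    refine Asymptotics.IsBigO.of_bound 1 (Eventually.of_forall fun y => ?_)
    simp only [truncPow, sub_zero, norm_pow, norm_norm, one_mul]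
    refine pow_le_pow_left₀ (norm_nonneg _) ?_ _
    rw [Real.norm_eq_abs, Real.norm_eq_abs, abs_of_nonneg (le_max_right _ _)]
    exact max_le (le_abs_self y) (abs_nonneg y)
  · rw [truncPow_of_nonneg hx.le]
    have := hasDerivAt_pow (k + 1) x
    simp only [add_tsub_cancel_right] at this
    push_cast at this
    refine this.congr_of_eventuallyEq ?_
    filter_upwards [Ioi_mem_nhds hx] with y hy
    exact truncPow_of_nonneg (le_of_lt hy)

lemma continuous_truncPow (k : ℕ) : Continuous (truncPow k) := by
  unfold truncPow; fun_prop

lemma contDiff_truncPow_two : ContDiff ℝ 1 (truncPow 2) := by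
  rw [contDiff_one_iff_deriv]
  refine ⟨fun x => (hasDerivAt_truncPow le_rfl x).differentiableAt, ?_⟩
  have : deriv (truncPow 2) = fun x => ((1 : ℕ) + 1) * truncPow 1 x :=
    funext fun x => (hasDerivAt_truncPow le_rfl x).deriv
  rw [this]
  exact continuous_const.mul (continuous_truncPow 1)

lemma contDiff_truncPow_three : ContDiff ℝ 2 (truncPow 3) := by
  rw [show (2 : WithTop ℕ∞) = 1 + 1 by norm_num, contDiff_succ_iff_deriv]
  refine ⟨fun x => (hasDerivAt_truncPow one_le_two x).differentiableAt, by simp, ?_⟩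
  have : deriv (truncPow 3) = fun x => ((2 : ℕ) + 1) * truncPow 2 x :=
    funext fun x => (hasDerivAt_truncPow one_le_two x).deriv
  rw [this]
  exact contDiff_const.mul contDiff_truncPow_two

/-- The fourth difference of the truncated power of degree `k`. -/
noncomputable def diffPow (k : ℕ) (x : ℝ) : ℝ :=
  truncPow k x - 4 * truncPow k (x - 1) + 6 * truncPow k (x - 2) - 4 * truncPow k (x - 3)
    + truncPow k (x - 4)

/-- The cubic B-spline supported on `[0, 4]`. -/
noncomputable def spline (x : ℝ) : ℝ := diffPow 3 x / 6

lemma hasDerivAt_diffPow {k : ℕ} (hk : 1 ≤ k) (x : ℝ) :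
    HasDerivAt (diffPow (k + 1)) ((k + 1) * diffPow k x) x := by
  have h : ∀ c : ℝ, HasDerivAt (fun x => truncPow (k + 1) (x - c))
      ((k + 1) * truncPow k (x - c)) x := fun c => by
    simpa using (hasDerivAt_truncPow hk (x - c)).comp_sub_const x c
  convert! ((((hasDerivAt_truncPow hk x).sub ((h 1).const_mul 4)).add ((h 2).const_mul 6)).sub
    ((h 3).const_mul 4)).add (h 4) using 1
  unfold diffPow; ring

lemma diffPow_of_nonpos {k : ℕ} (hk : k ≠ 0) {x : ℝ} (hx : x ≤ 0) : diffPow k x = 0 := by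
  unfold diffPow
  rw [truncPow_of_nonpos hk hx, truncPow_of_nonpos hk (by linarith),
    truncPow_of_nonpos hk (by linarith), truncPow_of_nonpos hk (by linarith),
    truncPow_of_nonpos hk (by linarith)]
  ring

lemma diffPow_of_four_le {k : ℕ} (hk : k ≤ 3) {x : ℝ} (hx : 4 ≤ x) : diffPow k x = 0 := by
  unfold diffPow
  rw [truncPow_of_nonneg (by linarith), truncPow_of_nonneg (by linarith),
    truncPow_of_nonneg (by linarith), truncPow_of_nonneg (by linarith),
    truncPow_of_nonneg (by linarith)]
  interval_cases k <;> ring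

lemma hasDerivAt_spline (x : ℝ) : HasDerivAt spline (diffPow 2 x / 2) x := by
  convert! (hasDerivAt_diffPow (k := 2) one_le_two x).div_const 6 using 1
  push_cast; ring

lemma hasDerivAt_diffPow_two_div_two (x : ℝ) :
    HasDerivAt (fun x => diffPow 2 x / 2) (diffPow 1 x) x := by
  convert! (hasDerivAt_diffPow (k := 1) le_rfl x).div_const 2 using 1
  push_cast; ring

lemma contDiff_spline : ContDiff ℝ 2 spline := by
  have h : ∀ c : ℝ, ContDiff ℝ 2 fun x => truncPow 3 (x - c) := fun c =>
    contDiff_truncPow_three.comp (contDiff_id.sub contDiff_const)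
  unfold spline diffPow
  exact (((((contDiff_truncPow_three.sub (contDiff_const.mul (h 1))).add
    (contDiff_const.mul (h 2))).sub (contDiff_const.mul (h 3))).add (h 4))).div_const 6

lemma continuous_diffPow (k : ℕ) : Continuous (diffPow k) := by
  have h : ∀ c : ℝ, Continuous fun x => truncPow k (x - c) := fun c =>
    (continuous_truncPow k).comp (continuous_id.sub continuous_const)
  unfold diffPow
  exact ((((continuous_truncPow k).sub (continuous_const.mul (h 1))).add
    (continuous_const.mul (h 2))).sub (continuous_const.mul (h 3))).add (h 4)

lemma spline_nonneg (x : ℝ) : 0 ≤ spline x := by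
  unfold spline
  refine div_nonneg ?_ (by norm_num)
  rcases le_total x 0 with h0 | h0
  · rw [diffPow_of_nonpos (by norm_num) h0]
  rcases le_total 4 x with h4 | h4
  · rw [diffPow_of_four_le le_rfl h4]
  unfold diffPow
  rw [truncPow_of_nonneg h0, truncPow_of_nonpos (x := x - 4) (by norm_num) (by linarith)]
  rcases le_total x 1 with h1 | h1
  · rw [truncPow_of_nonpos (by norm_num) (by linarith),
      truncPow_of_nonpos (by norm_num) (by linarith),
      truncPow_of_nonpos (by norm_num) (by linarith)]
    have : 0 ≤ x ^ 3 := by positivity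
    linarith
  rw [truncPow_of_nonneg (x := x - 1) (by linarith)]
  rcases le_total x 2 with h2 | h2
  · rw [truncPow_of_nonpos (by norm_num) (by linarith),
      truncPow_of_nonpos (by norm_num) (by linarith)]
    have a1 : 0 ≤ x - 1 := by linarith
    have a2 : 0 ≤ 2 - x := by linarith
    -- Since `x = (2 - x) + 2(x - 1)`, the cubic is a form in `2 - x` and `x - 1` with positive
    -- coefficients; the interval `[2, 3]` is the mirror image.
    have : x ^ 3 - 4 * (x - 1) ^ 3 = (2 - x) ^ 3 + 6 * (x - 1) * (2 - x) ^ 2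
      + 12 * (x - 1) ^ 2 * (2 - x) + 4 * (x - 1) ^ 3 := by ring
    nlinarith [pow_nonneg a2 3, mul_nonneg a1 (sq_nonneg (2 - x)),
      mul_nonneg (sq_nonneg (x - 1)) a2, pow_nonneg a1 3]
  rw [truncPow_of_nonneg (x := x - 2) (by linarith)]
  have a1 : 0 ≤ 4 - x := by linarith
  rcases le_total x 3 with h3 | h3
  · rw [truncPow_of_nonpos (by norm_num) (by linarith)]
    have a2 : 0 ≤ 3 - x := by linarith
    have a3 : 0 ≤ x - 2 := by linarith
    have : x ^ 3 - 4 * (x - 1) ^ 3 + 6 * (x - 2) ^ 3 - 4 * 0 + 0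
        = (x - 2) ^ 3 + 6 * (3 - x) * (x - 2) ^ 2 + 12 * (3 - x) ^ 2 * (x - 2)
          + 4 * (3 - x) ^ 3 := by ring
    rw [this]; positivity
  · rw [truncPow_of_nonneg (by linarith)]
    have : x ^ 3 - 4 * (x - 1) ^ 3 + 6 * (x - 2) ^ 3 - 4 * (x - 3) ^ 3 + 0 = (4 - x) ^ 3 := by ring
    rw [this]; positivity

/-- The binomial coefficients `C(4, i)`. -/
def binomFour (i : Fin 5) : ℝ := ![1, 4, 6, 4, 1] i

lemma binomFour_nonneg (i : Fin 5) : 0 ≤ binomFour i := by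
  fin_cases i <;> simp [binomFour]

/-- With `H` the shift by `1/2`, the spline is the fourth difference `(1 - H²)⁴` of the truncated
cube, and `(1 - H²)⁴ = (1 + H)⁴ (1 - H)⁴`. The factor `(1 + H)⁴` gives the binomial coefficients;
homogeneity of the cube and the rescaling give the factor `1/8`. Nonnegative coefficients are what
make adaptive subdivision harmless. -/
lemma spline_refinement (x : ℝ) :
    spline x = ∑ i : Fin 5, binomFour i / 8 * spline (2 * x - (i : ℕ)) := by
  have h : ∀ y, truncPow 3 y = truncPow 3 (2 * y) / 8 := fun y => by
    rcases le_total y 0 with hy | hy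
    · rw [truncPow_of_nonpos (by norm_num) hy, truncPow_of_nonpos (by norm_num) (by linarith)]
      simp
    · rw [truncPow_of_nonneg hy, truncPow_of_nonneg (by linarith)]; ring
  have e : spline x = (truncPow 3 (2 * x) - 4 * truncPow 3 (2 * (x - 1))
      + 6 * truncPow 3 (2 * (x - 2)) - 4 * truncPow 3 (2 * (x - 3))
      + truncPow 3 (2 * (x - 4))) / 48 := by
    unfold spline diffPow
    rw [h x, h (x - 1), h (x - 2), h (x - 3), h (x - 4)]; ring
  rw [e]
  simp only [Fin.sum_univ_five, binomFour, spline, diffPow]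
  simp
  ring_nf

/-- Integer shifts of the spline sum to one; for `|x| ≤ 1` the shifts from `-5` to `4` include all
that are nonzero at `x`. -/
lemma sum_spline_eq_one {x : ℝ} (hx : |x| ≤ 1) :
    ∑ k : Fin 10, spline (x - ((k : ℕ) - 5 : ℝ)) = 1 := by
  obtain ⟨h1, h2⟩ := abs_le.1 hx
  have hp : ∀ c : ℝ, 1 ≤ c → truncPow 3 (x + c) = (x + c) ^ 3 := fun c hc =>
    truncPow_of_nonneg (by linarith)
  have hn : ∀ c : ℝ, c ≤ -1 → truncPow 3 (x + c) = 0 := fun c hc =>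
    truncPow_of_nonpos (by norm_num) (by linarith)
  simp only [Fin.sum_univ_succ, spline, diffPow, sub_eq_add_neg, add_assoc]
  simp
  norm_num [hp, hn]
  rcases le_total x 0 with h | h
  · rw [truncPow_of_nonpos (by norm_num) h]; ring
  · rw [truncPow_of_nonneg h]; ring

/-! ### Tensor product splines in the plane -/

/-- The tensor product spline at scale `s` with lower left corner `a`. -/
noncomputable def bump (s : ℝ) (a z : ℂ) : ℝ :=
  spline ((z.re - a.re) / s) * spline ((z.im - a.im) / s)

/-- The open box on which `bump s a` lives. -/
def box (s : ℝ) (a : ℂ) : Set ℂ :=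
  {z | (z.re - a.re) / s ∈ Ioo (0 : ℝ) 4 ∧ (z.im - a.im) / s ∈ Ioo (0 : ℝ) 4}

lemma bump_nonneg (s : ℝ) (a z : ℂ) : 0 ≤ bump s a z :=
  mul_nonneg (spline_nonneg _) (spline_nonneg _)

lemma contDiff_bump (s : ℝ) (a : ℂ) : ContDiff ℝ 2 (bump s a) :=
  (contDiff_spline.comp ((contDiff_re.sub contDiff_const).div_const s)).mul
    (contDiff_spline.comp ((contDiff_im.sub contDiff_const).div_const s))

lemma laplacian_bump (s : ℝ) (a z : ℂ) : Δ (bump s a) z =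
    s⁻¹ ^ 2 * (diffPow 1 ((z.re - a.re) / s) * spline ((z.im - a.im) / s)
      + spline ((z.re - a.re) / s) * diffPow 1 ((z.im - a.im) / s)) := by
  have hre : ∀ w, HasFDerivAt (fun w : ℂ => (w.re - a.re) / s) (s⁻¹ • Complex.reCLM) w := fun w =>
    by simpa [div_eq_mul_inv] using (Complex.reCLM.hasFDerivAt.sub_const _).mul_const s⁻¹
  have him : ∀ w, HasFDerivAt (fun w : ℂ => (w.im - a.im) / s) (s⁻¹ • Complex.imCLM) w := fun w =>
    by simpa [div_eq_mul_inv] using (Complex.imCLM.hasFDerivAt.sub_const _).mul_const s⁻¹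
  have h1 := fun w => (hasDerivAt_spline ((w.re - a.re) / s)).comp_hasFDerivAt w (hre w)
  have h2 := fun w => (hasDerivAt_spline ((w.im - a.im) / s)).comp_hasFDerivAt w (him w)
  have d1 := (hasDerivAt_diffPow_two_div_two ((z.re - a.re) / s)).comp_hasFDerivAt z (hre z)
  have d2 := (hasDerivAt_diffPow_two_div_two ((z.im - a.im) / s)).comp_hasFDerivAt z (him z)
  have hA : ∀ w, HasFDerivAt (bump s a)
      (((diffPow 2 ((w.re - a.re) / s) / 2 * spline ((w.im - a.im) / s)) * s⁻¹) • Complex.reCLM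
        + ((spline ((w.re - a.re) / s) * (diffPow 2 ((w.im - a.im) / s) / 2)) * s⁻¹)
          • Complex.imCLM) w := by
    intro w
    convert! (h1 w).mul (h2 w) using 1
    ext <;> (simp; ring)
  rw [laplacian_eq_of_hasFDerivAt (contDiff_bump s a).contDiffAt hA
    ((d1.mul (h2 z)).mul_const s⁻¹) (((h1 z).mul d2).mul_const s⁻¹)]
  simp
  ring

lemma spline_eq_zero {x : ℝ} (hx : x ∉ Ioo (0 : ℝ) 4) : spline x = 0 := by
  rw [mem_Ioo, not_and_or, not_lt, not_lt] at hx
  unfold spline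
  rcases hx with hx | hx
  · rw [diffPow_of_nonpos (by norm_num) hx, zero_div]
  · rw [diffPow_of_four_le le_rfl hx, zero_div]

lemma diffPow_one_eq_zero {x : ℝ} (hx : x ∉ Ioo (0 : ℝ) 4) : diffPow 1 x = 0 := by
  rw [mem_Ioo, not_and_or, not_lt, not_lt] at hx
  rcases hx with hx | hx
  · exact diffPow_of_nonpos (by norm_num) hx
  · exact diffPow_of_four_le (by norm_num) hx

lemma bump_eq_zero {s : ℝ} {a z : ℂ} (hz : z ∉ box s a) : bump s a z = 0 := by
  rw [box, mem_ofPred_eq, not_and_or] at hz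
  unfold bump
  rcases hz with hz | hz <;> simp [spline_eq_zero hz]

lemma laplacian_bump_eq_zero {s : ℝ} {a z : ℂ} (hz : z ∉ box s a) : Δ (bump s a) z = 0 := by
  rw [box, mem_ofPred_eq, not_and_or] at hz
  rw [laplacian_bump]
  rcases hz with hz | hz <;> simp [spline_eq_zero hz, diffPow_one_eq_zero hz]

/-- Second derivatives scale as `s⁻²`; the profile functions `spline` and `diffPow 1` are continuous
with compact support, hence bounded. -/
lemma exists_abs_laplacian_bump_le :
    ∃ K : ℝ, 0 < K ∧ ∀ (s : ℝ) (a z : ℂ), |Δ (bump s a) z| ≤ s⁻¹ ^ 2 * K := by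
  have hs : HasCompactSupport spline := HasCompactSupport.of_support_subset_isCompact
    (isCompact_Icc (a := (0 : ℝ)) (b := 4)) fun x hx => by
      by_contra h; exact hx (spline_eq_zero fun h' => h (Ioo_subset_Icc_self h'))
  have hd : HasCompactSupport (diffPow 1) := HasCompactSupport.of_support_subset_isCompact
    (isCompact_Icc (a := (0 : ℝ)) (b := 4)) fun x hx => by
      by_contra h; exact hx (diffPow_one_eq_zero fun h' => h (Ioo_subset_Icc_self h'))
  obtain ⟨M, hM⟩ := hs.exists_bound_of_continuous contDiff_spline.continuous
  obtain ⟨N, hN⟩ := hd.exists_bound_of_continuous (continuous_diffPow 1)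
  have hM0 : 0 ≤ M := (norm_nonneg _).trans (hM 0)
  have hN0 : 0 ≤ N := (norm_nonneg _).trans (hN 0)
  simp only [Real.norm_eq_abs] at hM hN
  refine ⟨N * M + M * N + 1, by positivity, fun s a z => ?_⟩
  rw [laplacian_bump, abs_mul, abs_of_nonneg (by positivity : 0 ≤ s⁻¹ ^ 2)]
  refine mul_le_mul_of_nonneg_left ?_ (by positivity)
  refine (abs_add_le _ _).trans ?_
  rw [abs_mul, abs_mul]
  have h1 := mul_le_mul (hN ((z.re - a.re) / s)) (hM ((z.im - a.im) / s)) (abs_nonneg _) hN0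
  have h2 := mul_le_mul (hM ((z.re - a.re) / s)) (hN ((z.im - a.im) / s)) (abs_nonneg _) hM0
  linarith

lemma norm_sub_lt_of_mem_box {s : ℝ} (hs : 0 < s) {a z : ℂ} (hz : z ∈ box s a) :
    ‖z - a‖ < 8 * s := by
  obtain ⟨⟨h1, h2⟩, h3, h4⟩ := hz
  rw [div_lt_iff₀ hs] at h2 h4
  rw [lt_div_iff₀ hs] at h1 h3
  have := Complex.norm_le_abs_re_add_abs_im (z - a)
  rw [Complex.sub_re, Complex.sub_im, abs_of_pos (by linarith), abs_of_pos (by linarith)] at this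
  linarith

lemma hasCompactSupport_bump {s : ℝ} (hs : 0 < s) (a : ℂ) : HasCompactSupport (bump s a) :=
  HasCompactSupport.of_support_subset_isCompact (isCompact_closedBall a (8 * s)) fun z hz => by
    by_contra h
    refine hz (bump_eq_zero fun h' => h ?_)
    rw [mem_closedBall_iff_norm]
    exact (norm_sub_lt_of_mem_box hs h').le

lemma bump_refinement {s : ℝ} (hs : 0 < s) (a z : ℂ) :
    bump s a z = ∑ p : Fin 5 × Fin 5, binomFour p.1 / 8 * (binomFour p.2 / 8) *
      bump (s / 2) (a + (s / 2 : ℝ) * ((p.1 : ℕ) + (p.2 : ℕ) * Complex.I)) z := by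
  unfold bump
  rw [spline_refinement ((z.re - a.re) / s), spline_refinement ((z.im - a.im) / s),
    Finset.sum_mul_sum, Fintype.sum_prod_type]
  refine Finset.sum_congr rfl fun i _ => Finset.sum_congr rfl fun j _ => ?_
  have e1 : (z.re - (a + (s / 2 : ℝ) * ((i : ℕ) + (j : ℕ) * Complex.I)).re) / (s / 2)
      = 2 * ((z.re - a.re) / s) - (i : ℕ) := by
    simp; field_simp; ring
  have e2 : (z.im - (a + (s / 2 : ℝ) * ((i : ℕ) + (j : ℕ) * Complex.I)).im) / (s / 2)
      = 2 * ((z.im - a.im) / s) - (j : ℕ) := by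
    simp; field_simp; ring
  rw [e1, e2]; ring

lemma sum_bump_eq_one {s : ℝ} (hs : 0 < s) {z : ℂ} (h1 : |z.re| ≤ s) (h2 : |z.im| ≤ s) :
    ∑ p : Fin 10 × Fin 10, bump s ((s : ℝ) * (((p.1 : ℕ) - 5 : ℝ) + ((p.2 : ℕ) - 5 : ℝ)
      * Complex.I)) z = 1 := by
  have hx : |z.re / s| ≤ 1 := by rw [abs_div, abs_of_pos hs, div_le_one hs]; exact h1
  have hy : |z.im / s| ≤ 1 := by rw [abs_div, abs_of_pos hs, div_le_one hs]; exact h2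
  calc _ = ∑ p : Fin 10 × Fin 10, spline (z.re / s - ((p.1 : ℕ) - 5 : ℝ))
        * spline (z.im / s - ((p.2 : ℕ) - 5 : ℝ)) := by
        refine Finset.sum_congr rfl fun p _ => ?_
        unfold bump
        congr 2
        · simp; field_simp
        · simp; field_simp
    _ = 1 := by
        rw [Fintype.sum_prod_type]
        dsimp only
        rw [← Finset.sum_mul_sum, sum_spline_eq_one hx,
          sum_spline_eq_one hy, mul_one]

/-- The integral of the unit bump. -/
noncomputable def bumpMass : ℝ := ∫ z, bump 1 0 z

lemma bumpMass_pos : 0 < bumpMass := by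
  refine Continuous.integral_pos_of_hasCompactSupport_nonneg_nonzero (x := 2 + 2 * Complex.I)
    (contDiff_bump 1 0).continuous (hasCompactSupport_bump one_pos 0)
    (fun z => bump_nonneg _ _ _) ?_
  have : spline 2 = 2 / 3 := by
    unfold spline diffPow
    rw [truncPow_of_nonneg (by norm_num), truncPow_of_nonneg (by norm_num),
      truncPow_of_nonneg (by norm_num), truncPow_of_nonpos (by norm_num) (by norm_num),
      truncPow_of_nonpos (by norm_num) (by norm_num)]
    norm_num
  simp [bump, this]

lemma integral_bump {s : ℝ} (hs : 0 < s) (a : ℂ) : ∫ z, bump s a z = s ^ 2 * bumpMass := by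
  have h2 := Measure.integral_comp_smul (volume : Measure ℂ) (fun z : ℂ => bump s a (a + z)) s
  simp only [Complex.finrank_real_complex, smul_eq_mul] at h2
  rw [integral_add_left_eq_self (fun z => bump s a z) a, abs_of_pos (by positivity)] at h2
  have e : ∀ x : ℂ, bump s a (a + s • x) = bump 1 0 x := fun x => by
    unfold bump
    congr 2
    · simp; field_simp
    · simp; field_simp
  simp only [e] at h2
  unfold bumpMass
  rw [h2]; field_simp

lemma integrable_bump {s : ℝ} (hs : 0 < s) (a : ℂ) : Integrable (bump s a) :=
  (contDiff_bump s a).continuous.integrable_of_hasCompactSupport (hasCompactSupport_bump hs a)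

/-! ### Adaptive subdivision of a partition of unity -/

/-- A spline whose scale is comparable to the value of `ρ` at its corner. -/
structure IsAdapted (ρ : ℂ → ℝ) (s : ℝ) (a : ℂ) : Prop where
  one_le : 1 ≤ s
  le : 200 * s ≤ ρ a
  ge : ρ a ≤ 408 * s

/-- A scale function: `1`-Lipschitz and bounded below by `200`. -/
structure IsScale (ρ : ℂ → ℝ) : Prop where
  lip : ∀ z w, ρ z ≤ ρ w + ‖z - w‖
  ge : ∀ z, 200 ≤ ρ z

/-- A finite nonnegative combination of adapted splines. -/
structure AdaptedFamily (ρ : ℂ → ℝ) where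
  ι : Type
  [fin : Fintype ι]
  weight : ι → ℝ
  scale : ι → ℝ
  corner : ι → ℂ
  weight_nonneg : ∀ i, 0 ≤ weight i
  adapted : ∀ i, IsAdapted ρ (scale i) (corner i)

attribute [instance] AdaptedFamily.fin

namespace AdaptedFamily

variable {ρ : ℂ → ℝ}

/-- The value at `z` of the `i`-th spline of the family. -/
noncomputable def fn (F : AdaptedFamily ρ) (i : F.ι) : ℂ → ℝ := bump (F.scale i) (F.corner i)

/-- The box of the `i`-th spline of the family. -/
def dom (F : AdaptedFamily ρ) (i : F.ι) : Set ℂ := box (F.scale i) (F.corner i)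

lemma scale_pos (F : AdaptedFamily ρ) (i : F.ι) : 0 < F.scale i :=
  one_pos.trans_le (F.adapted i).one_le

/-- The union of finitely many families, with weights multiplied by given factors. -/
def sigma {κ : Type} [Fintype κ] (v : κ → ℝ) (hv : ∀ k, 0 ≤ v k) (F : κ → AdaptedFamily ρ) :
    AdaptedFamily ρ where
  ι := Σ k, (F k).ι
  weight p := v p.1 * (F p.1).weight p.2
  scale p := (F p.1).scale p.2
  corner p := (F p.1).corner p.2
  weight_nonneg p := mul_nonneg (hv _) ((F p.1).weight_nonneg _)
  adapted p := (F p.1).adapted _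

lemma sum_sigma {κ : Type} [Fintype κ] (v : κ → ℝ) (hv : ∀ k, 0 ≤ v k) (F : κ → AdaptedFamily ρ)
    (z : ℂ) : ∑ p, (sigma v hv F).weight p * (sigma v hv F).fn p z
      = ∑ k, v k * ∑ i, (F k).weight i * (F k).fn i z := by
  simp only [Finset.mul_sum]
  have : ∑ p : (Σ k, (F k).ι), v p.1 * (F p.1).weight p.2 * (F p.1).fn p.2 z
      = ∑ k, ∑ i, v k * (F k).weight i * (F k).fn i z := Fintype.sum_sigma _
  refine this.trans (Finset.sum_congr rfl fun k _ => Finset.sum_congr rfl fun i _ => by ring)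

end AdaptedFamily

/-- Subdivide while the scale is too large for `ρ`. If `ρ a < 200 · 2^(n+1) = 400 · 2^n`, the
corners of the pieces at scale `2^n` lie within `8 · 2^n` of `a`, so the Lipschitz bound gives `ρ ≤
408 · 2^n` there: the upper bound is inherited. The process stops by scale `1`, because `ρ ≥ 200`.
-/
lemma exists_adaptedFamily_bump {ρ : ℂ → ℝ} (hρ : IsScale ρ) (n : ℕ) : ∀ a : ℂ,
    ρ a ≤ 408 * 2 ^ n →
    ∃ F : AdaptedFamily ρ, ∀ z, bump (2 ^ n) a z = ∑ i, F.weight i * F.fn i z := by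
  have base : ∀ (n : ℕ) (a : ℂ), ρ a ≤ 408 * 2 ^ n → 200 * 2 ^ n ≤ ρ a →
      ∃ F : AdaptedFamily ρ, ∀ z, bump (2 ^ n) a z = ∑ i, F.weight i * F.fn i z := by
    intro n a h1 h2
    refine ⟨{ ι := Unit, weight := fun _ => 1, scale := fun _ => 2 ^ n, corner := fun _ => a,
              weight_nonneg := fun _ => zero_le_one,
              adapted := fun _ => ⟨one_le_pow₀ one_le_two, h2, h1⟩ }, fun z => ?_⟩
    simp [AdaptedFamily.fn]
  induction n with
  | zero =>
    intro a h
    exact base 0 a h (by simpa using hρ.ge a)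
  | succ n ih =>
    intro a h
    rcases le_or_gt (200 * 2 ^ (n + 1)) (ρ a) with h2 | h2
    · exact base _ a h h2
    have hs : (0 : ℝ) < 2 ^ (n + 1) := by positivity
    have e2 : (2 : ℝ) ^ (n + 1) / 2 = 2 ^ n := by rw [pow_succ]; ring
    have key : ∀ p : Fin 5 × Fin 5, ρ (a + ((2 : ℝ) ^ (n + 1) / 2 : ℝ)
        * ((p.1 : ℕ) + (p.2 : ℕ) * Complex.I)) ≤ 408 * 2 ^ n := by
      intro p
      have h3 := hρ.lip (a + ((2 : ℝ) ^ (n + 1) / 2 : ℝ) * ((p.1 : ℕ) + (p.2 : ℕ) * Complex.I)) a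
      have h4 : ‖((p.1 : ℕ) + (p.2 : ℕ) * Complex.I : ℂ)‖ ≤ 8 := by
        refine (norm_add_le _ _).trans ?_
        rw [norm_mul, Complex.norm_I, mul_one, Complex.norm_natCast, Complex.norm_natCast]
        have h5 : ((p.1 : ℕ) : ℝ) ≤ 4 := by exact_mod_cast Nat.lt_succ_iff.1 p.1.2
        have h6 : ((p.2 : ℕ) : ℝ) ≤ 4 := by exact_mod_cast Nat.lt_succ_iff.1 p.2.2
        linarith
      rw [add_sub_cancel_left, norm_mul, Complex.norm_real, e2,
        Real.norm_of_nonneg (by positivity)] at h3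
      rw [e2]
      have h7 : (2 : ℝ) ^ n * ‖((p.1 : ℕ) + (p.2 : ℕ) * Complex.I : ℂ)‖ ≤ 2 ^ n * 8 :=
        mul_le_mul_of_nonneg_left h4 (by positivity)
      rw [pow_succ] at h2
      linarith
    choose F hF using fun p => ih _ (key p)
    refine ⟨AdaptedFamily.sigma (fun p : Fin 5 × Fin 5 => binomFour p.1 / 8 * (binomFour p.2 / 8))
      (fun p => mul_nonneg (div_nonneg (binomFour_nonneg _) (by norm_num))
        (div_nonneg (binomFour_nonneg _) (by norm_num))) F, fun z => ?_⟩
    rw [AdaptedFamily.sum_sigma, bump_refinement hs]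
    refine Finset.sum_congr rfl fun p _ => ?_
    rw [← hF p z, e2]

/-- Start from 100 bumps at scale `2^n`. Their corners have norm at most `10 · 2^n`, so `ρ ≤ 11 ·
2^n` there, well within the bound `408 · 2^n` required for subdivision. -/
lemma exists_adaptedFamily_partition {ρ : ℂ → ℝ} (hρ : IsScale ρ) (n : ℕ) (hn : ρ 0 ≤ 2 ^ n) :
    ∃ F : AdaptedFamily ρ, ∀ z : ℂ, |z.re| ≤ 2 ^ n → |z.im| ≤ 2 ^ n →
      ∑ i, F.weight i * F.fn i z = 1 := by
  have key : ∀ p : Fin 10 × Fin 10, ρ (((2 : ℝ) ^ n : ℝ) * (((p.1 : ℕ) - 5 : ℝ)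
      + ((p.2 : ℕ) - 5 : ℝ) * Complex.I)) ≤ 408 * 2 ^ n := by
    intro p
    have h3 := hρ.lip (((2 : ℝ) ^ n : ℝ) * (((p.1 : ℕ) - 5 : ℝ)
      + ((p.2 : ℕ) - 5 : ℝ) * Complex.I)) 0
    have h4 : ‖((((p.1 : ℕ) - 5 : ℝ) : ℂ) + (((p.2 : ℕ) - 5 : ℝ) : ℂ) * Complex.I)‖ ≤ 10 := by
      refine (norm_add_le _ _).trans ?_
      have h : ∀ q : Fin 10, ‖(((q : ℕ) - 5 : ℝ) : ℂ)‖ ≤ 5 := fun q => by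
        rw [Complex.norm_real, Real.norm_eq_abs, abs_le]
        have h5 : ((q : ℕ) : ℝ) ≤ 9 := by exact_mod_cast Nat.lt_succ_iff.1 q.2
        have h6 : (0 : ℝ) ≤ ((q : ℕ) : ℝ) := by positivity
        constructor <;> linarith
      rw [norm_mul, Complex.norm_I, mul_one]
      linarith [h p.1, h p.2]
    rw [sub_zero, norm_mul, Complex.norm_real, Real.norm_of_nonneg (by positivity)] at h3
    have h7 := mul_le_mul_of_nonneg_left h4 (by positivity : (0 : ℝ) ≤ 2 ^ n)
    have h8 : (0 : ℝ) < 2 ^ n := by positivity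
    push_cast at h3 h7 ⊢
    linarith
  choose F hF using fun p => exists_adaptedFamily_bump hρ n _ (key p)
  refine ⟨AdaptedFamily.sigma (fun _ => 1) (fun _ => zero_le_one) F, fun z h1 h2 => ?_⟩
  rw [AdaptedFamily.sum_sigma]
  refine Eq.trans ?_ (sum_bump_eq_one (by positivity : (0 : ℝ) < 2 ^ n) h1 h2)
  refine Finset.sum_congr rfl fun p _ => ?_
  rw [one_mul, ← hF p z]

/-! ### Localization of the Laplacian of a partial sum -/

namespace AdaptedFamily

variable {ρ : ℂ → ℝ} (F : AdaptedFamily ρ)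

/-- The part of the combination carried by the indices in `J`. -/
noncomputable def combo (J : Finset F.ι) (z : ℂ) : ℝ := ∑ i ∈ J, F.weight i * F.fn i z

/-- The mass of the `i`-th weighted spline. -/
noncomputable def mass (i : F.ι) : ℝ := F.weight i * ∫ z, F.fn i z

lemma contDiff_fn (i : F.ι) : ContDiff ℝ 2 (F.fn i) := contDiff_bump _ _

lemma hasCompactSupport_fn (i : F.ι) : HasCompactSupport (F.fn i) :=
  hasCompactSupport_bump (F.scale_pos i) _

lemma fn_nonneg (i : F.ι) (z : ℂ) : 0 ≤ F.fn i z := bump_nonneg _ _ _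

lemma contDiff_combo (J : Finset F.ι) : ContDiff ℝ 2 (F.combo J) :=
  ContDiff.sum fun i _ => contDiff_const.mul (F.contDiff_fn i)

lemma combo_nonneg (J : Finset F.ι) (z : ℂ) : 0 ≤ F.combo J z :=
  Finset.sum_nonneg fun i _ => mul_nonneg (F.weight_nonneg i) (F.fn_nonneg i z)

lemma combo_mono {J J' : Finset F.ι} (h : J ⊆ J') (z : ℂ) : F.combo J z ≤ F.combo J' z :=
  Finset.sum_le_sum_of_subset_of_nonneg h fun i _ _ =>
    mul_nonneg (F.weight_nonneg i) (F.fn_nonneg i z)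

lemma hasCompactSupport_combo (J : Finset F.ι) : HasCompactSupport (F.combo J) := by
  classical
  unfold combo
  induction J using Finset.induction_on with
  | empty =>
    simp only [Finset.sum_empty]
    exact HasCompactSupport.zero
  | insert i J hi ih =>
    simp only [Finset.sum_insert hi]
    exact ((F.hasCompactSupport_fn i).mul_left).add ih

lemma laplacian_combo (J : Finset F.ι) (z : ℂ) :
    Δ (F.combo J) z = ∑ i ∈ J, F.weight i * Δ (F.fn i) z := by
  classical
  induction J using Finset.induction_on with
  | empty =>
    have : F.combo ∅ = fun _ => 0 := by ext; simp [combo]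
    rw [this, laplacian_const]; simp
  | insert i J hi ih =>
    have e : F.combo (insert i J) = F.weight i • F.fn i + F.combo J := by
      ext w; simp [combo, Finset.sum_insert hi]
    have hs : ContDiff ℝ 2 (F.weight i • F.fn i) := contDiff_const.mul (F.contDiff_fn i)
    rw [e, ContDiffAt.laplacian_add hs.contDiffAt (F.contDiff_combo J).contDiffAt, Finset.sum_insert hi, ih,
      laplacian_smul _ (F.contDiff_fn i).contDiffAt]
    simp

lemma integrable_combo (J : Finset F.ι) : Integrable (F.combo J) :=
  (F.contDiff_combo J).continuous.integrable_of_hasCompactSupport (F.hasCompactSupport_combo J)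

lemma integral_combo (J : Finset F.ι) : ∫ z, F.combo J z = ∑ i ∈ J, F.mass i := by
  unfold combo mass
  rw [integral_finsetSum]
  · simp only [integral_const_mul]
  · exact fun i _ => (integrable_bump (F.scale_pos i) _).const_mul _

lemma combo_eq_zero {J : Finset F.ι} {z : ℂ} (h : ∀ i ∈ J, z ∉ F.dom i) : F.combo J z = 0 :=
  Finset.sum_eq_zero fun i hi => by
    have : F.fn i z = 0 := bump_eq_zero (h i hi)
    rw [this, mul_zero]

lemma laplacian_combo_eq_zero {J : Finset F.ι} {z : ℂ} (h : ∀ i ∈ J, z ∉ F.dom i) :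
    Δ (F.combo J) z = 0 := by
  rw [laplacian_combo]
  exact Finset.sum_eq_zero fun i hi => by
    have : Δ (F.fn i) z = 0 := laplacian_bump_eq_zero (h i hi)
    rw [this, mul_zero]

lemma dom_nonempty (i : F.ι) : (F.dom i).Nonempty := by
  have := F.scale_pos i
  refine ⟨F.corner i + (F.scale i : ℝ) * (1 + Complex.I), ?_⟩
  simp [dom, box, this.ne']

open Classical in
/-- The indices whose boxes meet a box with index in `J`. -/
noncomputable def nbhd (J : Finset F.ι) : Finset F.ι :=
  Finset.univ.filter fun i => ∃ j ∈ J, (F.dom i ∩ F.dom j).Nonempty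

lemma mem_nbhd {J : Finset F.ι} {i : F.ι} :
    i ∈ F.nbhd J ↔ ∃ j ∈ J, (F.dom i ∩ F.dom j).Nonempty := by
  simp [nbhd]

lemma subset_nbhd (J : Finset F.ι) : J ⊆ F.nbhd J := fun i hi =>
  F.mem_nbhd.2 ⟨i, hi, by simpa using F.dom_nonempty i⟩

/-- The family sums to one on the open square of half-side `S`. -/
def IsPartition (S : ℝ) : Prop :=
  ∀ z : ℂ, |z.re| < S → |z.im| < S → F.combo Finset.univ z = 1

variable {F}

lemma IsPartition.laplacian_eq_zero {S : ℝ} (h : F.IsPartition S) {z : ℂ} (h1 : |z.re| < S)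
    (h2 : |z.im| < S) : Δ (F.combo Finset.univ) z = 0 := by
  have : F.combo Finset.univ =ᶠ[𝓝 z] fun _ => 1 := by
    have o1 : IsOpen {w : ℂ | |w.re| < S} :=
      isOpen_lt (Complex.continuous_re.abs) continuous_const
    have o2 : IsOpen {w : ℂ | |w.im| < S} :=
      isOpen_lt (Complex.continuous_im.abs) continuous_const
    filter_upwards [o1.mem_nhds h1, o2.mem_nhds h2] with w hw1 hw2
    exact h w hw1 hw2
  rw [(laplacian_congr_nhds this).eq_of_nhds, laplacian_const]; rfl

-- At a point of a box from `J`, every spline living there belongs to `nbhd J`, so the sum over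
-- `nbhd J` has zero Laplacian and the sum over `J` has minus that of the difference. Off the boxes
-- of `J` the sum over `J` has zero Laplacian and the sum over `nbhd J` has that of the difference.
-- Either way only `nbhd J \ J` enters, each index with its own weight, so no count of overlaps is
-- needed.
open Classical in
lemma IsPartition.abs_laplacian_le {S : ℝ} (h : F.IsPartition S) {J : Finset F.ι}
    (hJ : ∀ i ∈ F.nbhd J, ∀ z ∈ F.dom i, |z.re| < S ∧ |z.im| < S) {J' : Finset F.ι}
    (hJ' : J' = J ∨ J' = F.nbhd J) (z : ℂ) :
    |Δ (F.combo J') z| ≤ ∑ i ∈ F.nbhd J \ J, F.weight i * |Δ (F.fn i) z| := by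
  have hsub := F.subset_nbhd J
  have hJs : J' ⊆ F.nbhd J := by rcases hJ' with rfl | rfl <;> simp [hsub]
  have habs : |∑ i ∈ F.nbhd J \ J, F.weight i * Δ (F.fn i) z|
      ≤ ∑ i ∈ F.nbhd J \ J, F.weight i * |Δ (F.fn i) z| := by
    refine (Finset.abs_sum_le_sum_abs _ _).trans (Finset.sum_le_sum fun i _ => ?_)
    rw [abs_mul, abs_of_nonneg (F.weight_nonneg i)]
  have hnn : 0 ≤ ∑ i ∈ F.nbhd J \ J, F.weight i * |Δ (F.fn i) z| :=
    Finset.sum_nonneg fun i _ => mul_nonneg (F.weight_nonneg i) (abs_nonneg _)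
  have hsplit := Finset.sum_sdiff hsub (f := fun i => F.weight i * Δ (F.fn i) z)
  by_cases hz : ∀ i ∈ F.nbhd J, z ∉ F.dom i
  · rw [laplacian_combo_eq_zero F fun i hi => hz i (hJs hi), abs_zero]
    exact hnn
  push Not at hz
  obtain ⟨i₀, hi₀, hzi₀⟩ := hz
  obtain ⟨hz1, hz2⟩ := hJ i₀ hi₀ z hzi₀
  by_cases hz0 : ∃ j ∈ J, z ∈ F.dom j
  · obtain ⟨j, hj, hzj⟩ := hz0
    have hN : Δ (F.combo (F.nbhd J)) z = 0 := by
      rw [← h.laplacian_eq_zero hz1 hz2, laplacian_combo, laplacian_combo]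
      refine Finset.sum_subset (Finset.subset_univ _) fun i _ hi => ?_
      have : z ∉ F.dom i := fun hzi => hi (F.mem_nbhd.2 ⟨j, hj, z, hzi, hzj⟩)
      have : Δ (F.fn i) z = 0 := laplacian_bump_eq_zero this
      rw [this, mul_zero]
    rcases hJ' with rfl | rfl
    · rw [laplacian_combo] at hN ⊢
      rw [hN] at hsplit
      rw [eq_neg_of_add_eq_zero_right hsplit, abs_neg]
      exact habs
    · rw [hN, abs_zero]; exact hnn
  · push Not at hz0
    have hN := laplacian_combo_eq_zero F hz0
    rcases hJ' with rfl | rfl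
    · rw [hN, abs_zero]; exact hnn
    · rw [laplacian_combo] at hN ⊢
      rw [hN, add_zero] at hsplit
      rw [← hsplit]
      exact habs

open Classical in
lemma IsPartition.abs_integral_le {S : ℝ} (h : F.IsPartition S) {J : Finset F.ι}
    (hJ : ∀ i ∈ F.nbhd J, ∀ z ∈ F.dom i, |z.re| < S ∧ |z.im| < S) {J' : Finset F.ι}
    (hJ' : J' = J ∨ J' = F.nbhd J) {φ : ℂ → ℝ}
    (hi : ∀ i, Integrable fun z => φ z * Δ (F.fn i) z)
    (hφ : ∀ i, ∫ z, |φ z * Δ (F.fn i) z| ≤ ∫ z, F.fn i z) :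
    |∫ z, φ z * Δ (F.combo J') z| ≤ ∑ i ∈ F.nbhd J \ J, F.mass i := by
  have hle : ∀ z, |φ z * Δ (F.combo J') z|
      ≤ ∑ i ∈ F.nbhd J \ J, F.weight i * |φ z * Δ (F.fn i) z| := fun z => by
    rw [abs_mul]
    refine (mul_le_mul_of_nonneg_left (h.abs_laplacian_le hJ hJ' z) (abs_nonneg _)).trans_eq ?_
    rw [Finset.mul_sum]
    exact Finset.sum_congr rfl fun i _ => by rw [abs_mul]; ring
  have hint : ∀ i ∈ F.nbhd J \ J, Integrable fun z => F.weight i * |φ z * Δ (F.fn i) z| :=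
    fun i _ => (hi i).abs.const_mul _
  calc |∫ z, φ z * Δ (F.combo J') z| ≤ ∫ z, |φ z * Δ (F.combo J') z| := abs_integral_le_integral_abs
    _ ≤ ∫ z, ∑ i ∈ F.nbhd J \ J, F.weight i * |φ z * Δ (F.fn i) z| :=
        integral_mono_of_nonneg (Eventually.of_forall fun z => abs_nonneg _)
          (integrable_finsetSum _ hint) (Eventually.of_forall hle)
    _ = ∑ i ∈ F.nbhd J \ J, F.weight i * ∫ z, |φ z * Δ (F.fn i) z| := by
        rw [integral_finsetSum _ hint]; simp only [integral_const_mul]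
    _ ≤ ∑ i ∈ F.nbhd J \ J, F.mass i := Finset.sum_le_sum fun i _ =>
        mul_le_mul_of_nonneg_left (hφ i) (F.weight_nonneg i)

end AdaptedFamily

/-! ### The radius as a length scale, and the choice of the constant -/

lemma enorm_realPotential_le (ψ : ℂ → ℂ) (z : ℂ) :
    ‖realPotential ψ z‖ₑ ≤ (potential ψ z).abs := by
  by_cases h : ψ z = 0
  · have : potential ψ z = ⊥ := by
      simp only [potential, h, enorm_zero, ENNReal.log_zero]
      rw [EReal.coe_mul_bot_of_pos (by norm_num)]
      simp
    rw [this, EReal.abs_bot]; exact le_top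
  · have : potential ψ z = (realPotential ψ z : ℝ) := by
      simp only [potential, realPotential]
      rw [ENNReal.log_pos_real (by simpa using h) (by simp), toReal_enorm]
      push_cast
      rfl
    rw [this, EReal.abs_def, Real.enorm_eq_ofReal_abs]

lemma measurable_realPotential {ψ : ℂ → ℂ} (hψ : Continuous ψ) : Measurable (realPotential ψ) := by
  unfold realPotential
  exact ((Real.measurable_log.comp hψ.norm.measurable).const_mul _).sub
    ((continuous_norm.measurable.pow_const 2).div_const 4)

section Radius

variable {C : ℝ≥0} {χ : ℂ → ℝ} {ψ : ℂ → ℂ}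

/-- A supremum of functions that are 1-Lipschitz in `z` is 1-Lipschitz. -/
lemma radius_le_add (z w : ℂ) : radius C χ ψ z ≤ radius C χ ψ w + ‖z - w‖ₑ := by
  refine iSup_le fun v => ?_
  set x := ((C : ℝ≥0∞) * (1 + absPotentialConv χ ψ v)) ^ (1 / 2 : ℝ)
  have h1 : x - ‖v - w‖ₑ ≤ radius C χ ψ w :=
    le_iSup (fun v => ((C : ℝ≥0∞) * (1 + absPotentialConv χ ψ v)) ^ (1 / 2 : ℝ) - ‖v - w‖ₑ) v
  have h2 : ‖v - w‖ₑ ≤ ‖v - z‖ₑ + ‖z - w‖ₑ := by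
    have := enorm_add_le (v - z) (z - w)
    simpa using this
  rw [tsub_le_iff_right]
  calc x ≤ (x - ‖v - w‖ₑ) + ‖v - w‖ₑ := le_tsub_add
    _ ≤ radius C χ ψ w + (‖v - z‖ₑ + ‖z - w‖ₑ) := add_le_add h1 h2
    _ = radius C χ ψ w + ‖z - w‖ₑ + ‖v - z‖ₑ := by ring

lemma radius_lt_top (h : radius C χ ψ 0 < ⊤) (z : ℂ) : radius C χ ψ z < ⊤ :=
  (radius_le_add z 0).trans_lt (ENNReal.add_lt_top.2 ⟨h, by simp⟩)

/-- The term `w = z` of the supremum; it bounds the averaged potential by the square of the radius.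
-/
lemma mul_le_radius_sq (w : ℂ) :
    (C : ℝ≥0∞) * (1 + absPotentialConv χ ψ w) ≤ radius C χ ψ w ^ 2 := by
  have h := le_iSup (fun v => ((C : ℝ≥0∞) * (1 + absPotentialConv χ ψ v)) ^ (1 / 2 : ℝ)
    - ‖v - w‖ₑ) w
  simp only [sub_self, enorm_zero, tsub_zero] at h
  have h2 := ENNReal.rpow_le_rpow h (by norm_num : (0 : ℝ) ≤ 2)
  rw [← ENNReal.rpow_mul] at h2
  norm_num at h2
  exact h2

/-- The radius as a real function. -/
noncomputable def realRadius (C : ℝ≥0) (χ : ℂ → ℝ) (ψ : ℂ → ℂ) (z : ℂ) : ℝ := (radius C χ ψ z).toReal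

lemma realRadius_nonneg (z : ℂ) : 0 ≤ realRadius C χ ψ z := ENNReal.toReal_nonneg

lemma ofReal_realRadius (h : radius C χ ψ 0 < ⊤) (z : ℂ) :
    ENNReal.ofReal (realRadius C χ ψ z) = radius C χ ψ z :=
  ENNReal.ofReal_toReal (radius_lt_top h z).ne

/-- The threshold is `40000 = 200²`, so that `R² ≥ C` yields `R ≥ 200`. -/
lemma isScale_realRadius (hC : 40000 ≤ C) (h : radius C χ ψ 0 < ⊤) :
    IsScale (realRadius C χ ψ) := by
  refine ⟨fun z w => ?_, fun z => ?_⟩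
  · have h1 := ENNReal.toReal_mono (ENNReal.add_lt_top.2 ⟨radius_lt_top h w, by simp⟩).ne
      (radius_le_add (C := C) (χ := χ) (ψ := ψ) z w)
    rwa [ENNReal.toReal_add (radius_lt_top h w).ne (by simp), toReal_enorm] at h1
  · have h1 : (40000 : ℝ≥0∞) ≤ radius C χ ψ z ^ 2 := by
      refine le_trans ?_ (mul_le_radius_sq z)
      calc (40000 : ℝ≥0∞) ≤ (C : ℝ≥0∞) * 1 := by rw [mul_one]; exact_mod_cast hC
        _ ≤ _ := by gcongr; exact le_self_add
    have h2 := ENNReal.toReal_mono (ENNReal.pow_lt_top (radius_lt_top h z)).ne h1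
    rw [ENNReal.toReal_pow] at h2
    have h3 : 0 ≤ realRadius C χ ψ z := ENNReal.toReal_nonneg
    have h4 : (40000 : ℝ) ≤ realRadius C χ ψ z ^ 2 := by simpa [realRadius] using h2
    nlinarith

lemma absPotentialConv_le (hC : 0 < C) (h : radius C χ ψ 0 < ⊤) (w : ℂ) :
    absPotentialConv χ ψ w ≤ ENNReal.ofReal (realRadius C χ ψ w ^ 2 / C) := by
  have h1 := mul_le_radius_sq (C := C) (χ := χ) (ψ := ψ) w
  rw [← ofReal_realRadius h, ← ENNReal.ofReal_pow (realRadius_nonneg w)] at h1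
  rw [ENNReal.ofReal_div_of_pos (by exact_mod_cast hC), ENNReal.ofReal_coe_nnreal,
    ENNReal.le_div_iff_mul_le (by left; exact_mod_cast hC.ne') (by simp), mul_comm]
  refine le_trans ?_ h1
  gcongr
  exact le_add_self


end Radius

lemma IsKernel.lintegral_eq_one {χ : ℂ → ℝ} (hχ : IsKernel χ) (z : ℂ) :
    ∫⁻ w, ENNReal.ofReal (χ (w - z)) = 1 := by
  rw [lintegral_sub_right_eq_self (fun w => ENNReal.ofReal (χ w)) z,
    ← ofReal_integral_eq_lintegral_ofReal
      (hχ.smooth.continuous.integrable_of_hasCompactSupport hχ.compactSupport)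
      (Eventually.of_forall hχ.nonneg), hχ.integral_eq_one, ENNReal.ofReal_one]

lemma IsKernel.exists_radius {χ : ℂ → ℝ} (hχ : IsKernel χ) :
    ∃ r : ℝ, 0 < r ∧ ∀ z, r ≤ ‖z‖ → χ z = 0 := by
  obtain ⟨r, hr⟩ := hχ.compactSupport.isBounded.subset_ball (0 : ℂ)
  refine ⟨max r 1, by positivity, fun z hz => image_eq_zero_of_notMem_tsupport fun h => ?_⟩
  have := hr h
  rw [mem_ball_zero_iff] at this
  exact absurd (le_max_left r 1) (not_le.2 (hz.trans_lt this))

/-- For `ψ = 0` the potential is `-∞` everywhere, so its averaged absolute value is infinite. -/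
lemma ne_zero_of_radius_lt_top {C : ℝ≥0} {χ : ℂ → ℝ} {ψ : ℂ → ℂ} (hχ : IsKernel χ) (hC : 0 < C)
    (h : radius C χ ψ 0 < ⊤) : ψ ≠ 0 := by
  rintro rfl
  have h1 := (absPotentialConv_le hC h 0).trans_lt ENNReal.ofReal_lt_top
  have h2 : ∀ z, (potential 0 z).abs = ⊤ := fun z => by
    have : potential 0 z = ⊥ := by
      simp only [potential, Pi.zero_apply, enorm_zero, ENNReal.log_zero]
      rw [EReal.coe_mul_bot_of_pos (by norm_num)]
      simp
    rw [this, EReal.abs_bot]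
  have h3 : ∫⁻ z, ENNReal.ofReal (χ (0 - z)) = 1 := by
    rw [← hχ.lintegral_eq_one 0]
    congr 1; ext z
    rw [zero_sub, sub_zero, hχ.even]
  unfold absPotentialConv at h1
  simp only [h2] at h1
  rw [lintegral_const_mul _ (by have := hχ.smooth.continuous; fun_prop), h3] at h1
  simp at h1

/-- The integral of `|φ|` over a ball is controlled by that of `|φ| * χ` over a larger one. -/
lemma setLIntegral_enorm_realPotential_le {χ : ℂ → ℝ} {ψ : ℂ → ℂ} (hχ : IsKernel χ)
    (hψ : Continuous ψ) {r : ℝ} (hr : ∀ z, r ≤ ‖z‖ → χ z = 0) (a : ℂ) (t : ℝ) :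
    ∫⁻ z in Metric.ball a t, ‖realPotential ψ z‖ₑ
      ≤ ∫⁻ w in Metric.ball a (t + r), absPotentialConv χ ψ w := by
  have hχm : Measurable χ := hχ.smooth.continuous.measurable
  have hφm := measurable_realPotential hψ
  have hin : ∀ z ∈ Metric.ball a t,
      ∫⁻ w in Metric.ball a (t + r), ENNReal.ofReal (χ (w - z)) = 1 := by
    intro z hz
    rw [← hχ.lintegral_eq_one z, ← lintegral_indicator Metric.isOpen_ball.measurableSet]
    congr 1; ext w
    by_cases hw : w ∈ Metric.ball a (t + r)
    · simp [hw]
    · rw [indicator_of_notMem hw, hr, ENNReal.ofReal_zero]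
      rw [mem_ball_iff_norm] at hz hw
      have := norm_sub_le_norm_sub_add_norm_sub w z a
      linarith
  -- Insert `∫ χ(w - z) dw = 1`, where for `z` in the small ball only `w` in the enlarged ball
  -- matter, and exchange the integrals.
  calc ∫⁻ z in Metric.ball a t, ‖realPotential ψ z‖ₑ
      = ∫⁻ z in Metric.ball a t, ∫⁻ w in Metric.ball a (t + r),
          ‖realPotential ψ z‖ₑ * ENNReal.ofReal (χ (w - z)) := by
        refine setLIntegral_congr_fun Metric.isOpen_ball.measurableSet fun z hz => ?_
        rw [lintegral_const_mul _ (by fun_prop), hin z hz, mul_one]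
    _ = ∫⁻ w in Metric.ball a (t + r), ∫⁻ z in Metric.ball a t,
          ‖realPotential ψ z‖ₑ * ENNReal.ofReal (χ (w - z)) := by
        refine lintegral_lintegral_swap (Measurable.aemeasurable ?_)
        simp only [Function.uncurry_def]
        fun_prop
    _ ≤ ∫⁻ w in Metric.ball a (t + r), absPotentialConv χ ψ w := by
        refine lintegral_mono fun w => (setLIntegral_le_lintegral _ _).trans ?_
        refine lintegral_mono fun z => ?_
        gcongr
        exact enorm_realPotential_le ψ z

/-- For `C` large, depending only on `χ`, the error term of each adapted spline is at most its
mass. -/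
lemma exists_constant {χ : ℂ → ℝ} (hχ : IsKernel χ) :
    ∃ C : ℝ≥0, 40000 ≤ C ∧ ∀ ψ : ℂ → ℂ, Continuous ψ → radius C χ ψ 0 < ⊤ → ∀ (s : ℝ) (a : ℂ),
      IsAdapted (realRadius C χ ψ) s a →
        ∫ z, |realPotential ψ z * Δ (bump s a) z| ≤ ∫ z, bump s a z := by
  obtain ⟨K, hK, hKb⟩ := exists_abs_laplacian_bump_le
  obtain ⟨r, hr0, hr⟩ := hχ.exists_radius
  have hB := bumpMass_pos
  -- On the ball of radius `(8 + r)s`, of area `π(8 + r)²s²`, the radius is at most `408s + (8 + r)s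
  -- = (416 + r)s`. Multiplying area, squared radius over `C` and `K s⁻²` gives `C₀ · bumpMass · s²
  -- / C`, which is at most the bump's mass `s² · bumpMass` once `C ≥ C₀`.
  set C₀ : ℝ := K * (Real.pi * (8 + r) ^ 2 * (416 + r) ^ 2) / bumpMass with hC₀
  have hC₀p : 0 < C₀ := by positivity
  refine ⟨40000 + C₀.toNNReal, le_self_add, fun ψ hψ hrad s a ha => ?_⟩
  set C : ℝ≥0 := 40000 + C₀.toNNReal with hC
  have hCC : C₀ ≤ (C : ℝ) := by rw [hC]; push_cast; rw [Real.coe_toNNReal _ hC₀p.le]; linarith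
  have hCp : 0 < C := by rw [hC]; positivity
  have hCpr : (0 : ℝ) < C := by exact_mod_cast hCp
  have hscale := isScale_realRadius (C := C) (by rw [hC]; exact le_self_add) hrad
  have hs := ha.one_le
  have hs0 : 0 < s := by linarith
  have hball : ∫⁻ z in Metric.ball a (8 * s), ‖realPotential ψ z‖ₑ
      ≤ ENNReal.ofReal (Real.pi * (8 + r) ^ 2 * (416 + r) ^ 2 * s ^ 4 / C) := by
    -- Here `s ≥ 1` absorbs the support radius `r` of the kernel into the scale.
    have hsub : Metric.ball a (8 * s + r) ⊆ Metric.ball a ((8 + r) * s) :=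
      Metric.ball_subset_ball (by nlinarith)
    calc ∫⁻ z in Metric.ball a (8 * s), ‖realPotential ψ z‖ₑ
        ≤ ∫⁻ w in Metric.ball a (8 * s + r), absPotentialConv χ ψ w :=
          setLIntegral_enorm_realPotential_le hχ hψ hr a _
      _ ≤ ∫⁻ w in Metric.ball a ((8 + r) * s), absPotentialConv χ ψ w :=
          lintegral_mono_set hsub
      _ ≤ ∫⁻ w in Metric.ball a ((8 + r) * s), ENNReal.ofReal (((416 + r) * s) ^ 2 / C) := by
          refine setLIntegral_mono measurable_const fun w hw => ?_
          refine (absPotentialConv_le hCp hrad w).trans (ENNReal.ofReal_le_ofReal ?_)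
          have h1 := hscale.lip w a
          have h2 := ha.ge
          rw [mem_ball_iff_norm] at hw
          have h3 := hscale.ge w
          have h4 : realRadius C χ ψ w ≤ (416 + r) * s := by nlinarith
          gcongr
      _ = ENNReal.ofReal (Real.pi * (8 + r) ^ 2 * (416 + r) ^ 2 * s ^ 4 / C) := by
          rw [lintegral_const, Measure.restrict_apply_univ, Complex.volume_ball,
            ← ENNReal.ofReal_pow (by positivity), ← ENNReal.ofReal_coe_nnreal,
            ← ENNReal.ofReal_mul (by positivity), ← ENNReal.ofReal_mul (by positivity)]
          congr 1
          simp only [NNReal.coe_real_pi]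
          ring
  have hle : ∀ z, ‖realPotential ψ z * Δ (bump s a) z‖ₑ
      ≤ (Metric.ball a (8 * s)).indicator
        (fun z => ENNReal.ofReal (s⁻¹ ^ 2 * K) * ‖realPotential ψ z‖ₑ) z := by
    intro z
    by_cases hz : z ∈ Metric.ball a (8 * s)
    · rw [indicator_of_mem hz, enorm_mul, mul_comm]
      gcongr
      rw [Real.enorm_eq_ofReal_abs]
      exact ENNReal.ofReal_le_ofReal (hKb s a z)
    · have : z ∉ box s a := fun h => hz (mem_ball_iff_norm.2 (norm_sub_lt_of_mem_box hs0 h))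
      simp [laplacian_bump_eq_zero this]
  have hmain : ∫⁻ z, ‖realPotential ψ z * Δ (bump s a) z‖ₑ
      ≤ ENNReal.ofReal (s ^ 2 * bumpMass) := by
    calc ∫⁻ z, ‖realPotential ψ z * Δ (bump s a) z‖ₑ
        ≤ ∫⁻ z in Metric.ball a (8 * s),
            ENNReal.ofReal (s⁻¹ ^ 2 * K) * ‖realPotential ψ z‖ₑ := by
          rw [← lintegral_indicator Metric.isOpen_ball.measurableSet]
          exact lintegral_mono hle
      _ = ENNReal.ofReal (s⁻¹ ^ 2 * K) * ∫⁻ z in Metric.ball a (8 * s), ‖realPotential ψ z‖ₑ :=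
          lintegral_const_mul _ (measurable_realPotential hψ).enorm
      _ ≤ ENNReal.ofReal (s⁻¹ ^ 2 * K)
            * ENNReal.ofReal (Real.pi * (8 + r) ^ 2 * (416 + r) ^ 2 * s ^ 4 / C) := by gcongr
      _ ≤ ENNReal.ofReal (s ^ 2 * bumpMass) := by
          rw [← ENNReal.ofReal_mul (by positivity)]
          refine ENNReal.ofReal_le_ofReal ?_
          have e : s⁻¹ ^ 2 * K * (Real.pi * (8 + r) ^ 2 * (416 + r) ^ 2 * s ^ 4 / C)
              = s ^ 2 * (C₀ * bumpMass / C) := by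
            rw [hC₀]; field_simp
          rw [e]
          refine mul_le_mul_of_nonneg_left ?_ (by positivity)
          rw [div_le_iff₀ hCpr, mul_comm]
          gcongr
  rw [integral_bump hs0]
  have := integral_norm_eq_lintegral_enorm (μ := (volume : Measure ℂ))
    (f := fun z => realPotential ψ z * Δ (bump s a) z)
    ((measurable_realPotential hψ).mul
      (continuous_laplacian (contDiff_bump s a)).measurable).aestronglyMeasurable
  simp only [Real.norm_eq_abs] at this
  rw [this]
  exact ENNReal.toReal_le_of_le_ofReal (by positivity) hmain

/-! ### The lattice and its cells of area `π` -/

lemma sqrt_pi_pos : 0 < Real.sqrt Real.pi := Real.sqrt_pos.2 Real.pi_pos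

lemma one_le_sqrt_pi : 1 ≤ Real.sqrt Real.pi := Real.one_le_sqrt.2 (by linarith [Real.pi_gt_three])

lemma sqrt_pi_le : Real.sqrt Real.pi ≤ 9 / 5 :=
  Real.sqrt_le_iff.2 ⟨by norm_num, by linarith [Real.pi_lt_d2]⟩

/-- The point of the lattice `√π ℤ²` with given integer coordinates. -/
noncomputable def point (p : ℤ × ℤ) : ℂ :=
  (Real.sqrt Real.pi : ℂ) * ((p.1 : ℂ) + (p.2 : ℂ) * Complex.I)

lemma point_re (p : ℤ × ℤ) : (point p).re = Real.sqrt Real.pi * p.1 := by simp [point]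

lemma point_im (p : ℤ × ℤ) : (point p).im = Real.sqrt Real.pi * p.2 := by simp [point]

lemma point_injective : Function.Injective point := by
  intro p q h
  have h1 := congrArg Complex.re h
  have h2 := congrArg Complex.im h
  rw [point_re, point_re] at h1
  rw [point_im, point_im] at h2
  have h3 := mul_left_cancel₀ sqrt_pi_pos.ne' h1
  have h4 := mul_left_cancel₀ sqrt_pi_pos.ne' h2
  exact Prod.ext (by exact_mod_cast h3) (by exact_mod_cast h4)

lemma range_point : range point = lattice := by
  ext z
  constructor
  · rintro ⟨p, rfl⟩
    exact ⟨p.1, p.2, rfl⟩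
  · rintro ⟨k, l, rfl⟩
    exact ⟨(k, l), rfl⟩

/-- The integer coordinates of the lattice cell containing `z`. -/
noncomputable def cellIndex (z : ℂ) : ℤ × ℤ :=
  (⌊z.re / Real.sqrt Real.pi⌋, ⌊z.im / Real.sqrt Real.pi⌋)

lemma measurable_cellIndex : Measurable cellIndex :=
  (Int.measurable_floor.comp (Complex.measurable_re.div_const _)).prodMk
    (Int.measurable_floor.comp (Complex.measurable_im.div_const _))

lemma floor_div_sqrt_pi_eq {x : ℝ} {k : ℤ} : ⌊x / Real.sqrt Real.pi⌋ = k ↔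
    x ∈ Ico (Real.sqrt Real.pi * k) (Real.sqrt Real.pi * k + Real.sqrt Real.pi) := by
  rw [Int.floor_eq_iff, le_div_iff₀ sqrt_pi_pos, div_lt_iff₀ sqrt_pi_pos, mem_Ico]
  constructor <;> rintro ⟨h1, h2⟩ <;> constructor <;> linarith

lemma norm_sub_point_cellIndex_le (z : ℂ) : ‖z - point (cellIndex z)‖ ≤ 4 := by
  have h1 := (floor_div_sqrt_pi_eq (x := z.re)).1 rfl
  have h2 := (floor_div_sqrt_pi_eq (x := z.im)).1 rfl
  have h3 := Complex.norm_le_abs_re_add_abs_im (z - point (cellIndex z))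
  rw [Complex.sub_re, Complex.sub_im, point_re, point_im] at h3
  have e1 : (cellIndex z).1 = ⌊z.re / Real.sqrt Real.pi⌋ := rfl
  have e2 : (cellIndex z).2 = ⌊z.im / Real.sqrt Real.pi⌋ := rfl
  rw [e1, e2, abs_of_nonneg (by linarith [h1.1]), abs_of_nonneg (by linarith [h2.1])] at h3
  have := sqrt_pi_le
  linarith [h1.2, h2.2, h3]

lemma volume_cell (p : ℤ × ℤ) : volume (cellIndex ⁻¹' {p}) = ENNReal.ofReal Real.pi := by
  have e : cellIndex ⁻¹' {p} = Complex.measurableEquivRealProd ⁻¹'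
      (Ico (Real.sqrt Real.pi * p.1) (Real.sqrt Real.pi * p.1 + Real.sqrt Real.pi) ×ˢ
        Ico (Real.sqrt Real.pi * p.2) (Real.sqrt Real.pi * p.2 + Real.sqrt Real.pi)) := by
    ext z
    simp only [mem_preimage, mem_singleton_iff, cellIndex, Prod.ext_iff, floor_div_sqrt_pi_eq,
      mem_prod, Complex.measurableEquivRealProd_apply]
  rw [e, Complex.volume_preserving_equiv_real_prod.measure_preimage
    (measurableSet_Ico.prod measurableSet_Ico).nullMeasurableSet, Measure.volume_eq_prod,
    Measure.prod_prod, Real.volume_Ico, Real.volume_Ico, add_sub_cancel_left, add_sub_cancel_left,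
    ← ENNReal.ofReal_mul sqrt_pi_pos.le, Real.mul_self_sqrt Real.pi_pos.le]

lemma volume_cells (B : Finset (ℤ × ℤ)) :
    volume (cellIndex ⁻¹' (B : Set (ℤ × ℤ))) = ENNReal.ofReal (Real.pi * B.card) := by
  have e : cellIndex ⁻¹' (B : Set (ℤ × ℤ)) = ⋃ p ∈ B, cellIndex ⁻¹' {p} := by
    ext z; simp
  rw [e, measure_biUnion_finset]
  · simp only [volume_cell, Finset.sum_const, nsmul_eq_mul]
    rw [mul_comm Real.pi, ENNReal.ofReal_mul (by positivity), ENNReal.ofReal_natCast]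
  · intro p _ q _ hpq
    refine Set.disjoint_left.2 fun z hz hz' => hpq ?_
    rw [mem_preimage, mem_singleton_iff] at hz hz'
    exact hz.symm.trans hz'
  · exact fun p _ => measurable_cellIndex (measurableSet_singleton p)

lemma measurableSet_cells (B : Finset (ℤ × ℤ)) :
    MeasurableSet (cellIndex ⁻¹' (B : Set (ℤ × ℤ))) :=
  measurable_cellIndex B.measurableSet

lemma integral_indicator_cells (B : Finset (ℤ × ℤ)) :
    ∫ z, (cellIndex ⁻¹' (B : Set (ℤ × ℤ))).indicator (fun _ => (1 : ℝ)) z = Real.pi * B.card := by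
  rw [integral_indicator_const _ (measurableSet_cells B), Measure.real, volume_cells,
    ENNReal.toReal_ofReal (by positivity), smul_eq_mul, mul_one]

lemma integrable_indicator_cells (B : Finset (ℤ × ℤ)) :
    Integrable ((cellIndex ⁻¹' (B : Set (ℤ × ℤ))).indicator fun _ => (1 : ℝ)) :=
  (integrable_indicator_iff (measurableSet_cells B)).2
    (integrableOn_const (by rw [volume_cells]; exact ENNReal.ofReal_ne_top))

lemma finite_setOf_norm_point_le (M : ℝ) : {p : ℤ × ℤ | ‖point p‖ ≤ M}.Finite := by
  refine ((finite_Icc (-⌈M⌉) ⌈M⌉).prod (finite_Icc (-⌈M⌉) ⌈M⌉)).subset fun p hp => ?_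
  rw [mem_ofPred_eq] at hp
  have key : ∀ k : ℤ, |Real.sqrt Real.pi * k| ≤ M → k ∈ Icc (-⌈M⌉) ⌈M⌉ := by
    intro k hk
    rw [abs_mul, abs_of_pos sqrt_pi_pos] at hk
    have h1 : |(k : ℝ)| ≤ M :=
      (le_mul_of_one_le_left (abs_nonneg _) one_le_sqrt_pi).trans hk
    rw [mem_Icc, ← abs_le]
    have : (|k| : ℝ) ≤ (⌈M⌉ : ℝ) := h1.trans (Int.le_ceil M)
    exact_mod_cast this
  refine mk_mem_prod (key _ ?_) (key _ ?_)
  · rw [← point_re]; exact (Complex.abs_re_le_norm _).trans hp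
  · rw [← point_im]; exact (Complex.abs_im_le_norm _).trans hp

/-- The Lipschitz bound gives `ρ(p) ≤ ρ(0) + |p|`, so `|u - p| ≤ ρ(p)/2` forces `|p| ≤ ρ(0) + 2|u|`.
-/
lemma IsScale.finite_setOf_near {ρ : ℂ → ℝ} (hρ : IsScale ρ) (u : ℂ) :
    {p : ℤ × ℤ | ‖u - point p‖ ≤ ρ (point p) / 2}.Finite := by
  refine (finite_setOf_norm_point_le (ρ 0 + 2 * ‖u‖)).subset fun p hp => ?_
  rw [mem_ofPred_eq] at hp ⊢
  have h1 := hρ.lip (point p) 0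
  rw [sub_zero] at h1
  have h2 := norm_sub_norm_le (point p) u
  rw [norm_sub_rev] at h2
  linarith

/-! ### Zeros with multiplicity, and distances within the partition -/

lemma finite_zeros {ψ : ℂ → ℂ} (hψ : Differentiable ℂ ψ) (h0 : ψ ≠ 0) {K : Set ℂ}
    (hK : IsCompact K) : {z | z ∈ K ∧ ψ z = 0}.Finite := by
  by_contra hinf
  obtain ⟨z, _, hz⟩ := Set.Infinite.exists_accPt_of_subset_isCompact hinf hK fun z hz => hz.1
  rw [accPt_iff_frequently_nhdsNE] at hz
  refine h0 (funext fun w => ?_)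
  exact AnalyticOnNhd.eqOn_zero_of_preconnected_of_frequently_eq_zero
    (U := univ) (fun z _ => hψ.analyticAt z) isPreconnected_univ (mem_univ z)
    (hz.mono fun w hw => hw.2) (mem_univ w)

lemma mem_zerosWithMultiplicity {ψ : ℂ → ℂ} (hψ : Differentiable ℂ ψ) (h0 : ψ ≠ 0) {q : ℂ × ℕ} :
    q ∈ zerosWithMultiplicity ψ ↔ q.2 < mult ψ q.1 := by
  have h := Nat.cast_analyticOrderNatAt (analyticOrderAt_ne_top_of_entire hψ h0 q.1)
  rw [zerosWithMultiplicity, mem_ofPred_eq, ← h, Nat.cast_lt]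
  refine ⟨fun h => h.2, fun h => ⟨?_, h⟩⟩
  exact apply_eq_zero_of_analyticOrderNatAt_ne_zero (Nat.zero_lt_of_lt h).ne'

/-- Two points of a box are less than `16s` apart, while `ρ u ≥ 200s - 8s = 192s`. -/
lemma IsAdapted.norm_sub_le {ρ : ℂ → ℝ} (hρ : IsScale ρ) {s : ℝ} {a u v : ℂ}
    (h : IsAdapted ρ s a) (hu : u ∈ box s a) (hv : v ∈ box s a) : ‖v - u‖ ≤ ρ u / 12 := by
  have hs : 0 < s := one_pos.trans_le h.one_le
  have h1 := norm_sub_lt_of_mem_box hs hu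
  have h2 := norm_sub_lt_of_mem_box hs hv
  have h3 := hρ.lip a u
  rw [norm_sub_rev] at h3
  have h4 := norm_sub_le_norm_sub_add_norm_sub v a u
  rw [norm_sub_rev a u] at h4
  linarith [h.le]

namespace AdaptedFamily

variable {ρ : ℂ → ℝ} {F : AdaptedFamily ρ}

/-- Two steps through a common point `v`, with `ρ v ≤ (13/12) ρ u`: the constant is `1/12 + 13/144 =
25/144`. -/
lemma norm_sub_le_of_overlap (hρ : IsScale ρ) {i j : F.ι} {u v w : ℂ} (hu : u ∈ F.dom i)
    (hi : v ∈ F.dom i) (hj : v ∈ F.dom j) (hw : w ∈ F.dom j) : ‖w - u‖ ≤ 25 / 144 * ρ u := by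
  have h1 := (F.adapted i).norm_sub_le hρ hu hi
  have h2 := (F.adapted j).norm_sub_le hρ hj hw
  have h3 := hρ.lip v u
  have h4 := norm_sub_le_norm_sub_add_norm_sub w v u
  linarith

/-- Moving from `u` to its lattice point costs at most `4` in distance and in `ρ`; since `ρ ≥ 200`,
this fits between `25/144` and `1/2`. -/
lemma norm_sub_point_le_of_overlap (hρ : IsScale ρ) {i j : F.ι} {u v w : ℂ} (hu : u ∈ F.dom i)
    (hi : v ∈ F.dom i) (hj : v ∈ F.dom j) (hw : w ∈ F.dom j) :
    ‖w - point (cellIndex u)‖ ≤ ρ (point (cellIndex u)) / 2 := by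
  have h1 := norm_sub_le_of_overlap hρ hu hi hj hw
  have h2 := norm_sub_point_cellIndex_le u
  have h3 := hρ.lip u (point (cellIndex u))
  have h4 := norm_sub_le_norm_sub_add_norm_sub w u (point (cellIndex u))
  linarith [hρ.ge (point (cellIndex u))]

/-- The number of zeros weighted by a part of the partition, against the mass of that part. -/
lemma abs_pi_mul_sum_mult_sub_le {ψ : ℂ → ℂ} (hψ : Differentiable ℂ ψ) (h0 : ψ ≠ 0)
    (hkey : ∀ s a, IsAdapted ρ s a →
      ∫ z, |realPotential ψ z * Δ (bump s a) z| ≤ ∫ z, bump s a z)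
    {S : ℝ} (hF : F.IsPartition S) {J : Finset F.ι}
    (hJ : ∀ i ∈ F.nbhd J, ∀ z ∈ F.dom i, |z.re| < S ∧ |z.im| < S) {J' : Finset F.ι}
    (hJ' : J' = J ∨ J' = F.nbhd J) {Z : Finset ℂ}
    (hZ : ∀ z ∈ tsupport (F.combo J'), ψ z = 0 → z ∈ Z) :
    |Real.pi * ∑ a ∈ Z, (mult ψ a : ℝ) * F.combo J' a - ∑ i ∈ J', F.mass i|
      ≤ ∑ i ∈ F.nbhd J, F.mass i - ∑ i ∈ J, F.mass i := by
  classical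
  -- After this rewriting the left side is `|∫ φ Δ(combo J')|` and the right side is the mass of
  -- `nbhd J \ J`.
  rw [(integrable_realPotential_mul_laplacian_and_eq hψ h0 (F.contDiff_combo J')
    (F.hasCompactSupport_combo J') hZ).2, F.integral_combo, add_sub_cancel_left,
    ← Finset.sum_sdiff (F.subset_nbhd J), add_sub_cancel_right]
  refine hF.abs_integral_le hJ hJ' (fun i => ?_) fun i => hkey _ _ (F.adapted i)
  have hfin := finite_zeros hψ h0 (F.hasCompactSupport_fn i).isCompact
  exact (integrable_realPotential_mul_laplacian_and_eq hψ h0 (F.contDiff_fn i)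
    (F.hasCompactSupport_fn i) (Z := hfin.toFinset) fun z hz hz0 => by simp [hz, hz0]).1

lemma IsPartition.combo_le_one {S : ℝ} (hF : F.IsPartition S) {J : Finset F.ι}
    (hJ : ∀ i ∈ J, ∀ z ∈ F.dom i, |z.re| < S ∧ |z.im| < S) (z : ℂ) : F.combo J z ≤ 1 := by
  by_cases hz : ∀ i ∈ J, z ∉ F.dom i
  · rw [F.combo_eq_zero hz]; exact zero_le_one
  · push Not at hz
    obtain ⟨i, hi, hzi⟩ := hz
    obtain ⟨h1, h2⟩ := hJ i hi z hzi
    rw [← hF z h1 h2]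
    exact F.combo_mono (Finset.subset_univ J) z

lemma IsPartition.combo_eq_one {S : ℝ} (hF : F.IsPartition S) {J : Finset F.ι} {z : ℂ}
    (h1 : |z.re| < S) (h2 : |z.im| < S) (hJ : ∀ i, z ∈ F.dom i → i ∈ J) : F.combo J z = 1 := by
  rw [← hF z h1 h2]
  refine Finset.sum_subset (Finset.subset_univ _) fun i _ hi => ?_
  have : F.fn i z = 0 := bump_eq_zero fun h => hi (hJ i h)
  rw [this, mul_zero]

end AdaptedFamily

lemma exists_partition_radius_gt {ρ : ℂ → ℝ} (hρ : IsScale ρ) (M : ℝ) :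
    ∃ (S : ℝ) (F : AdaptedFamily ρ), M < S ∧ F.IsPartition S := by
  obtain ⟨n, hn⟩ := pow_unbounded_of_one_lt (max M (ρ 0)) one_lt_two
  obtain ⟨F, hF⟩ := exists_adaptedFamily_partition hρ n ((le_max_right _ _).trans hn.le)
  exact ⟨2 ^ n, F, (le_max_left _ _).trans_lt hn, fun z h1 h2 => hF z h1.le h2.le⟩

lemma abs_re_im_lt {z u : ℂ} {d S : ℝ} (h : ‖z - u‖ ≤ d) (hS : ‖u‖ + d < S) :
    |z.re| < S ∧ |z.im| < S := by
  have h1 : ‖z‖ < S := by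
    have := norm_add_le (z - u) u
    rw [sub_add_cancel] at this
    linarith
  exact ⟨(Complex.abs_re_le_norm z).trans_lt h1, (Complex.abs_im_le_norm z).trans_lt h1⟩

lemma exists_forall_mem_lt {α : Type*} (B : Finset α) (f : α → ℝ) : ∃ M, ∀ p ∈ B, f p ≤ M := by
  obtain ⟨M, hM⟩ := (B.finite_toSet.image f).bddAbove
  exact ⟨M, fun p hp => hM (mem_image_of_mem f hp)⟩

/-- The set of zeros within `ρ p / 2` of a lattice point, counted with multiplicity, is finite. -/
lemma finite_zeros_near {ψ : ℂ → ℂ} (hψ : Differentiable ℂ ψ) (h0 : ψ ≠ 0) (ρ : ℂ → ℝ)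
    (p : ℤ × ℤ) :
    {q : zerosWithMultiplicity ψ | ‖(q : ℂ × ℕ).1 - point p‖ ≤ ρ (point p) / 2}.Finite := by
  have h1 := finite_zeros hψ h0 (isCompact_closedBall (point p) (ρ (point p) / 2))
  have h2 : (⋃ a ∈ {z | z ∈ Metric.closedBall (point p) (ρ (point p) / 2) ∧ ψ z = 0},
      (Prod.mk a) '' (Iio (mult ψ a))).Finite :=
    h1.biUnion fun a _ => (finite_Iio _).image _
  refine Set.Finite.of_finite_image (f := Subtype.val) (h2.subset ?_) Subtype.val_injective.injOn
  rintro _ ⟨q, hq, rfl⟩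
  refine mem_biUnion (x := (q : ℂ × ℕ).1) ⟨?_, q.2.1⟩
    ⟨(q : ℂ × ℕ).2, (mem_zerosWithMultiplicity hψ h0).1 q.2, rfl⟩
  rw [mem_closedBall_iff_norm]; exact hq

/-! ### Hall's condition in both directions -/

section Hall

variable {ρ : ℂ → ℝ} {ψ : ℂ → ℂ} (hρ : IsScale ρ) (hψ : Differentiable ℂ ψ) (h0 : ψ ≠ 0)
  (hkey : ∀ s a, IsAdapted ρ s a →
    ∫ z, |realPotential ψ z * Δ (bump s a) z| ≤ ∫ z, bump s a z)

include hρ hψ h0 hkey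

/-- Every finite set of lattice points has at least as many zeros nearby. -/
lemma exists_zeros_near_lattice (B : Finset (ℤ × ℤ)) :
    ∃ Z : Finset ℂ, (∀ a ∈ Z, ∃ p ∈ B, ‖a - point p‖ ≤ ρ (point p) / 2) ∧
      B.card ≤ ∑ a ∈ Z, mult ψ a := by
  classical
  obtain ⟨M, hM⟩ := exists_forall_mem_lt B fun p => ‖point p‖ + ρ (point p) / 2
  obtain ⟨S, F, hMS, hF⟩ := exists_partition_radius_gt hρ M
  set J : Finset F.ι := Finset.univ.filter fun i => ∃ u ∈ F.dom i, cellIndex u ∈ B with hJdef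
  have hnear : ∀ i ∈ F.nbhd J, ∀ z ∈ F.dom i, ∃ p ∈ B, ‖z - point p‖ ≤ ρ (point p) / 2 := by
    intro i hi z hz
    obtain ⟨j, hj, v, hvi, hvj⟩ := F.mem_nbhd.1 hi
    obtain ⟨u, hu, huB⟩ := (Finset.mem_filter.1 hj).2
    exact ⟨_, huB, AdaptedFamily.norm_sub_point_le_of_overlap hρ hu hvj hvi hz⟩
  have hJ : ∀ i ∈ F.nbhd J, ∀ z ∈ F.dom i, |z.re| < S ∧ |z.im| < S := by
    intro i hi z hz
    obtain ⟨p, hp, hzp⟩ := hnear i hi z hz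
    exact abs_re_im_lt hzp ((hM p hp).trans_lt hMS)
  set Z₀ := (finite_zeros hψ h0 (F.hasCompactSupport_combo (F.nbhd J)).isCompact).toFinset
  have hZ₀ : ∀ z ∈ tsupport (F.combo (F.nbhd J)), ψ z = 0 → z ∈ Z₀ := fun z hz hz0 => by
    simp [Z₀, hz, hz0]
  -- Testing with `nbhd J` and using the lower bound cancels the mass of `nbhd J`: `π` times the
  -- weighted zero count is at least the mass of `J`.
  have hbal := (abs_le.1 (AdaptedFamily.abs_pi_mul_sum_mult_sub_le hψ h0 hkey hF hJ
    (Or.inr rfl) hZ₀)).1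
  -- The sum over `J` equals one on all cells of `B`, whose total area is `π |B|`.
  have hmass : Real.pi * B.card ≤ ∑ i ∈ J, F.mass i := by
    rw [← integral_indicator_cells, ← F.integral_combo]
    refine integral_mono (integrable_indicator_cells B) (F.integrable_combo J) fun z => ?_
    by_cases hz : z ∈ cellIndex ⁻¹' (B : Set (ℤ × ℤ))
    · rw [indicator_of_mem hz]
      have hzB : cellIndex z ∈ B := hz
      have h3 : ‖z - point (cellIndex z)‖ ≤ ρ (point (cellIndex z)) / 2 :=
        (norm_sub_point_cellIndex_le z).trans (by linarith [hρ.ge (point (cellIndex z))])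
      obtain ⟨h1, h2⟩ := abs_re_im_lt h3 ((hM _ hzB).trans_lt hMS)
      rw [hF.combo_eq_one h1 h2 fun i hi => Finset.mem_filter.2 ⟨Finset.mem_univ _, z, hi, hzB⟩]
    · rw [indicator_of_notMem hz]; exact F.combo_nonneg J z
  refine ⟨Z₀.filter fun a => ∃ p ∈ B, ‖a - point p‖ ≤ ρ (point p) / 2,
    fun a ha => (Finset.mem_filter.1 ha).2, ?_⟩
  have hsum : ∑ a ∈ Z₀, (mult ψ a : ℝ) * F.combo (F.nbhd J) a
      ≤ ∑ a ∈ Z₀.filter fun a => ∃ p ∈ B, ‖a - point p‖ ≤ ρ (point p) / 2, (mult ψ a : ℝ) := by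
    rw [Finset.sum_filter]
    refine Finset.sum_le_sum fun a _ => ?_
    split_ifs with ha
    · exact mul_le_of_le_one_right (by positivity) (hF.combo_le_one hJ a)
    · rw [F.combo_eq_zero fun i hi hai => ha (hnear i hi a hai), mul_zero]
  have h1 : Real.pi * (B.card : ℝ) ≤ Real.pi * ∑ a ∈ Z₀.filter fun a => ∃ p ∈ B,
      ‖a - point p‖ ≤ ρ (point p) / 2, (mult ψ a : ℝ) := by
    have := mul_le_mul_of_nonneg_left hsum Real.pi_pos.le
    linarith
  exact_mod_cast le_of_mul_le_mul_left h1 Real.pi_pos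

/-- Every finite set of zeros has at least as many lattice points nearby. -/
lemma exists_lattice_near_zeros (Z : Finset ℂ) :
    ∃ B : Finset (ℤ × ℤ), (∀ p ∈ B, ∃ a ∈ Z, ‖a - point p‖ ≤ ρ (point p) / 2) ∧
      ∑ a ∈ Z, mult ψ a ≤ B.card := by
  classical
  obtain ⟨M, hM⟩ := exists_forall_mem_lt Z fun a => ‖a‖ + 25 / 144 * ρ a
  obtain ⟨S, F, hMS, hF⟩ := exists_partition_radius_gt hρ M
  set J : Finset F.ι := Finset.univ.filter fun i => ∃ a ∈ Z, a ∈ F.dom i with hJdef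
  have hJ : ∀ i ∈ F.nbhd J, ∀ z ∈ F.dom i, |z.re| < S ∧ |z.im| < S := by
    intro i hi z hz
    obtain ⟨j, hj, v, hvi, hvj⟩ := F.mem_nbhd.1 hi
    obtain ⟨a, haZ, ha⟩ := (Finset.mem_filter.1 hj).2
    exact abs_re_im_lt (AdaptedFamily.norm_sub_le_of_overlap hρ ha hvj hvi hz)
      ((hM a haZ).trans_lt hMS)
  -- The identity needs every zero in the support, while the final comparison needs `Z` itself to be
  -- included.
  set Z₀ := Z ∪ (finite_zeros hψ h0 (F.hasCompactSupport_combo J).isCompact).toFinset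
  have hZ₀ : ∀ z ∈ tsupport (F.combo J), ψ z = 0 → z ∈ Z₀ := fun z hz hz0 => by
    simp [Z₀, hz, hz0]
  -- Testing with `J` and using the upper bound cancels the mass of `J`: `π` times the weighted zero
  -- count is at most the mass of `nbhd J`.
  have hbal := (abs_le.1 (AdaptedFamily.abs_pi_mul_sum_mult_sub_le hψ h0 hkey hF hJ
    (Or.inl rfl) hZ₀)).2
  have hfin : {p : ℤ × ℤ | ∃ a ∈ Z, ‖a - point p‖ ≤ ρ (point p) / 2}.Finite := by
    refine (Z.finite_toSet.biUnion fun a _ => hρ.finite_setOf_near a).subset fun p hp => ?_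
    obtain ⟨a, ha, hap⟩ := hp
    exact mem_biUnion ha hap
  refine ⟨hfin.toFinset, fun p hp => by simpa using hp, ?_⟩
  -- The sum over `nbhd J` is at most one and is supported in cells whose lattice points are near
  -- `Z`.
  have hmass : ∑ i ∈ F.nbhd J, F.mass i ≤ Real.pi * hfin.toFinset.card := by
    rw [← integral_indicator_cells, ← F.integral_combo]
    refine integral_mono (F.integrable_combo _) (integrable_indicator_cells _) fun z => ?_
    by_cases hz : ∀ i ∈ F.nbhd J, z ∉ F.dom i
    · rw [F.combo_eq_zero hz]
      exact indicator_nonneg (fun _ _ => zero_le_one) z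
    · push Not at hz
      obtain ⟨i, hi, hzi⟩ := hz
      obtain ⟨j, hj, v, hvi, hvj⟩ := F.mem_nbhd.1 hi
      obtain ⟨a, haZ, ha⟩ := (Finset.mem_filter.1 hj).2
      have hmem : z ∈ cellIndex ⁻¹' (hfin.toFinset : Set (ℤ × ℤ)) := by
        rw [mem_preimage, Set.Finite.coe_toFinset]
        exact ⟨a, haZ, AdaptedFamily.norm_sub_point_le_of_overlap hρ hzi hvi hvj ha⟩
      rw [indicator_of_mem hmem]
      exact hF.combo_le_one hJ z
  have hsum : ∑ a ∈ Z, (mult ψ a : ℝ) ≤ ∑ a ∈ Z₀, (mult ψ a : ℝ) * F.combo J a := by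
    refine le_trans (Finset.sum_le_sum fun a ha => ?_)
      (Finset.sum_le_sum_of_subset_of_nonneg Finset.subset_union_left fun a _ _ =>
        mul_nonneg (by positivity) (F.combo_nonneg J a))
    have hρa : (0 : ℝ) ≤ 25 / 144 * ρ a := by linarith [hρ.ge a]
    obtain ⟨h1, h2⟩ := abs_re_im_lt (z := a) (u := a) (by simpa using hρa)
      ((hM a ha).trans_lt hMS)
    rw [hF.combo_eq_one h1 h2 fun i hi => Finset.mem_filter.2 ⟨Finset.mem_univ _, a, ha, hi⟩,
      mul_one]
  have h1 : Real.pi * ∑ a ∈ Z, (mult ψ a : ℝ) ≤ Real.pi * (hfin.toFinset.card : ℝ) := by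
    have := mul_le_mul_of_nonneg_left hsum Real.pi_pos.le
    linarith
  exact_mod_cast le_of_mul_le_mul_left h1 Real.pi_pos

/-- Hall's marriage theorem for infinitely many points with finite candidate sets; a zero of
multiplicity `n` counts as `n` candidates. -/
lemma exists_injective_lattice_to_zeros :
    ∃ f : ℤ × ℤ → zerosWithMultiplicity ψ, Function.Injective f ∧
      ∀ p, ‖(f p : ℂ × ℕ).1 - point p‖ ≤ ρ (point p) / 2 := by
  classical
  have hfin := finite_zeros_near hψ h0 ρ
  obtain ⟨f, hf, hf2⟩ := (Finset.all_card_le_biUnion_card_iff_exists_injective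
    fun p => (hfin p).toFinset).1 fun B => by
      obtain ⟨Z, hZ, hB⟩ := exists_zeros_near_lattice hρ hψ h0 hkey B
      refine hB.trans ?_
      have e : ∑ a ∈ Z, mult ψ a
          = ((Z.sigma fun a => Finset.range (mult ψ a)).image fun x => (x.1, x.2)).card := by
        rw [Finset.card_image_of_injective _ (by rintro ⟨a, n⟩ ⟨b, m⟩ h; simpa using h),
          Finset.card_sigma]
        simp
      rw [e, ← Finset.card_map (Function.Embedding.subtype (· ∈ zerosWithMultiplicity ψ))]
      refine Finset.card_le_card fun q hq => ?_
      obtain ⟨⟨a, n⟩, han, rfl⟩ := Finset.mem_image.1 hq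
      rw [Finset.mem_sigma, Finset.mem_range] at han
      obtain ⟨p, hp, hap⟩ := hZ a han.1
      refine Finset.mem_map.2 ⟨⟨(a, n), (mem_zerosWithMultiplicity hψ h0).2 han.2⟩, ?_, rfl⟩
      exact Finset.mem_biUnion.2 ⟨p, hp, by simpa using hap⟩
  exact ⟨f, hf, fun p => by simpa using hf2 p⟩

lemma exists_injective_zeros_to_lattice :
    ∃ g : zerosWithMultiplicity ψ → ℤ × ℤ, Function.Injective g ∧
      ∀ q : zerosWithMultiplicity ψ, ‖(q : ℂ × ℕ).1 - point (g q)‖ ≤ ρ (point (g q)) / 2 := by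
  classical
  obtain ⟨g, hg, hg2⟩ := (Finset.all_card_le_biUnion_card_iff_exists_injective
    fun q : zerosWithMultiplicity ψ => (hρ.finite_setOf_near (q : ℂ × ℕ).1).toFinset).1
    fun Q => by
      obtain ⟨B, hB, hZ⟩ := exists_lattice_near_zeros hρ hψ h0 hkey
        (Q.image fun q => q.1.1)
      have h1 : Q.card ≤ ∑ a ∈ Q.image fun q => q.1.1, mult ψ a := by
        have e : ∑ a ∈ Q.image fun q => q.1.1, mult ψ a
            = ((Q.image fun q => q.1.1).sigma fun a => Finset.range (mult ψ a)).card := by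
          rw [Finset.card_sigma]; simp
        rw [e]
        refine Finset.card_le_card_of_injOn (fun q => ⟨q.1.1, q.1.2⟩)
          (fun q hq => ?_) fun q _ q' _ h => ?_
        · refine Finset.mem_coe.2 (Finset.mem_sigma.2 ⟨Finset.mem_image_of_mem _ hq, ?_⟩)
          exact Finset.mem_range.2 ((mem_zerosWithMultiplicity hψ h0).1 q.2)
        · simp only [Sigma.mk.injEq, heq_eq_eq] at h
          exact Subtype.ext (Prod.ext h.1 h.2)
      refine (h1.trans hZ).trans (Finset.card_le_card fun p hp => ?_)
      obtain ⟨a, ha, hap⟩ := hB p hp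
      obtain ⟨q, hq, rfl⟩ := Finset.mem_image.1 ha
      exact Finset.mem_biUnion.2 ⟨q, hq, by simpa using hap⟩
  exact ⟨g, hg, fun q => by simpa using hg2 q⟩

end Hall

end PerturbedLattice

/-! ### Assembling the bijection -/

theorem theorem4p1 (χ : ℂ → ℝ) (hχ : PerturbedLattice.IsKernel χ) :
    ∃ C : ℝ≥0, 1 ≤ C ∧ ∀ ψ : ℂ → ℂ, Differentiable ℂ ψ →
      PerturbedLattice.radius C χ ψ 0 < (⊤ : ℝ≥0∞) →
        ∃ e : PerturbedLattice.lattice ≃ PerturbedLattice.zerosWithMultiplicity ψ,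
          ∀ p : PerturbedLattice.lattice,
            ‖(e p : ℂ × ℕ).1 - (p : ℂ)‖ₑ ≤ PerturbedLattice.radius C χ ψ (p : ℂ) := by
  open PerturbedLattice in
  obtain ⟨C, hC, hkey⟩ := exists_constant hχ
  refine ⟨C, le_trans (by norm_num) hC, fun ψ hψ hrad => ?_⟩
  have hρ := isScale_realRadius hC hrad
  have h0 := ne_zero_of_radius_lt_top hχ (lt_of_lt_of_le (by norm_num) hC) hrad
  have hk := hkey ψ hψ.continuous hrad
  obtain ⟨f, hf, hf2⟩ := exists_injective_lattice_to_zeros hρ hψ h0 hk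
  obtain ⟨g, hg, hg2⟩ := exists_injective_zeros_to_lattice hρ hψ h0 hk
  -- The Schröder–Bernstein bijection pairs each point through `f` or through the inverse of `g`, so
  -- the distance relation satisfied by both passes to it.
  obtain ⟨h, hbij, hrel⟩ := Function.Embedding.schroeder_bernstein_of_rel hf hg
    (fun p q => ‖(q : ℂ × ℕ).1 - point p‖ ≤ realRadius C χ ψ (point p) / 2) hf2 hg2
  let e₀ : ℤ × ℤ ≃ lattice :=
    (Equiv.ofInjective point point_injective).trans (Equiv.setCongr range_point)
  refine ⟨e₀.symm.trans (Equiv.ofBijective h hbij), fun p => ?_⟩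
  obtain ⟨p, rfl⟩ := e₀.surjective p
  have hp : ((e₀ p : lattice) : ℂ) = point p := rfl
  rw [Equiv.trans_apply, Equiv.symm_apply_apply, Equiv.ofBijective_apply, hp,
    ← ofReal_realRadius hrad, ← ofReal_norm]
  refine ENNReal.ofReal_le_ofReal ((hrel p).trans ?_)
  linarith [realRadius_nonneg (C := C) (χ := χ) (ψ := ψ) (point p)]
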